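/- Let $\lambda>0$ and, for $n\ge 1$, let $\mathbb T_n=\mathbb Z/n\mathbb Z$. For $\eta\in\{0,1\}^{\mathbb T_n}$ put $$c_x(\eta)=\eta_x+(1-\eta_x)\,(1+\lambda\,\eta_{x-1}\eta_{x+1}),$$ and let $L_n$ be the operator on functions $g:\{0,1\}^{\mathbb T_n}\to\mathbb R$ given by $$L_ng(\eta)=n^2\sum_{x\in\mathbb T_n}\big[g(\eta^{x,x+1})-g(\eta)\big]+\sum_{x\in\mathbb T_n}c_x(\eta)\big[g(\eta^x)-g(\eta)\big],$$ where $\eta^{x,y}$ is $\eta$ with the values at $x$ and $y$ exchanged and $\eta^x$ is $\eta$ with the value at $x$ flipped. Denote by $\nu_m$ the Bernoulli product measure of density $m$ and let $$F(m)=\int\big\{(1-\eta_0)(1+\lambda\,\eta_{-1}\eta_{1})-\eta_0\big\}\,d\nu_m ,$$ the integral being over $\{0,1\}^{\mathbb Z}$. Let $\rho\in(0,1)$ satisfy $F(\rho)=0$, let $T>0$, and let $f:\mathbb R/\mathbb Z\to\mathbb R$ be smooth. For each $n\ge1$ let $(\eta^n(t))_{t\ge0}$ be the càdlàg Markov process on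 $\{0,1\}^{\mathbb T_n}$ with generator $L_n$ and initial law $\nu_\rho$, and let $$X^n_t(f)=n^{-1/2}\sum_{x\in\mathbb T_n}f\!\left(\tfrac xn\right)\big(\eta^n_x(t)-\rho\big);$$ $L_nX^n_t(f)$ denotes $L_n$ applied to the function $\eta\mapsto n^{-1/2}\sum_x f(x/n)(\eta_x-\rho)$, evaluated at $\eta^n(t)$. Then: 1. For every $\theta>1$ there is a constant $C>0$, depending only on $\theta,f,T,\lambda,\rho$, such that for all $n\ge1$ and all $s,t\in[0,T]$ $$\mathbb E_{\nu_\rho}\left[\left|\int_s^tL_nX^n_r(f)\,dr\right|^\theta\right]\le C\,|t-s|^\theta .$$ 2. The sequence of processes $\left\{\int_0^tL_nX^n_r(f)\,dr:\ t\in[0,T]\right\}_{n\ge1}$ is tight in $C([0,T];\mathbb R)$, that is, these processes are random elements of $C([0,T];\mathbb R)$ (with the uniform topology and its Borel $\sigma$-algebra) and their laws form a tight family. -/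

import Mathlib

open MeasureTheory ProbabilityTheory Filter Topology
open scoped unitInterval

noncomputable section

namespace ReactionDiffusion

/-! ### Markov processes on a finite state space -/

section Markov

variable {E : Type*} [Fintype E]

/-- The semigroup `exp (t L)` generated by an operator `L` on the functions `E → ℝ`. -/
def semigroup (L : (E → ℝ) →ₗ[ℝ] (E → ℝ)) (t : ℝ) : (E → ℝ) →L[ℝ] (E → ℝ) :=
  NormedSpace.exp (t • LinearMap.toContinuousLinearMap L)

/-- The σ-algebra generated by the process up to time `s`. -/
abbrev past {Ω : Type*} [MeasurableSpace E] (η : ℝ → Ω → E) (s : ℝ) : MeasurableSpace Ω :=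
  ⨆ r ∈ Set.Icc (0 : ℝ) s, MeasurableSpace.comap (η r) inferInstance

/-- `η` is, under `P`, a càdlàg Markov process in the finite state space `E` with infinitesimal
generator `L` and initial law `μ₀`. Only the times `t ≥ 0` matter. -/
structure IsMarkovProcess [TopologicalSpace E] [MeasurableSpace E]
    (L : (E → ℝ) →ₗ[ℝ] (E → ℝ)) (μ₀ : Measure E)
    {Ω : Type*} [MeasurableSpace Ω] (P : Measure Ω) (η : ℝ → Ω → E) : Prop where
  measurable : ∀ t, 0 ≤ t → Measurable (η t)
  right_continuous : ∀ ω t, 0 ≤ t → ContinuousWithinAt (fun r => η r ω) (Set.Ici t) t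
  left_limits : ∀ ω t, 0 < t → ∃ ζ, Tendsto (fun r => η r ω) (𝓝[<] t) (𝓝 ζ)
  initial : P.map (η 0) = μ₀
  markov : ∀ s t, 0 ≤ s → s ≤ t → ∀ g : E → ℝ,
    P[fun ω => g (η t ω) | past η s] =ᵐ[P] fun ω => semigroup L (t - s) g (η s ω)

end Markov

/-! ### The model -/

/-- Configurations of particles on a set of sites `G`; `true` is an occupied site. -/
abbrev Config (G : Type*) := G → Bool

/-- The occupation variable `η_x ∈ {0, 1}`, as a real number. -/
def occ {G : Type*} (η : Config G) (x : G) : ℝ := if η x then 1 else 0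

/-- The configuration `η^{x,y}` with the values at `x` and `y` exchanged. -/
def exchange {G : Type*} [DecidableEq G] (η : Config G) (x y : G) : Config G :=
  η ∘ Equiv.swap x y

/-- The configuration `η^x` with the value at `x` flipped. -/
def flip {G : Type*} [DecidableEq G] (η : Config G) (x : G) : Config G :=
  Function.update η x (!(η x))

/-- The Bernoulli product measure `ν_ρ` of density `ρ`. -/
def bernoulliProduct (G : Type*) (ρ : I) : Measure (Config G) :=
  Measure.infinitePi fun _ : G => bernoulliMeasure true false ρ

/-- The death rate `c_x^-`. -/
def deathRate {G : Type*} (_η : Config G) (_x : G) : ℝ := 1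

/-- The birth rate `c_x^+` in dimension one (used on the lattice `ℤ` and on the tori `ℤ/nℤ`). -/
def birthRate {G : Type*} [AddGroupWithOne G] (lam : ℝ) (η : Config G) (x : G) : ℝ :=
  1 + lam * (occ η (x - 1) * occ η (x + 1))

/-- The flip rate `c_x`. -/
def flipRate {G : Type*} [AddGroupWithOne G] (lam : ℝ) (η : Config G) (x : G) : ℝ :=
  occ η x * deathRate η x + (1 - occ η x) * birthRate lam η x

/-- The forcing term `F` of the hydrodynamic equation: the mean net rate of births at a site of the
lattice `ℤ` under the Bernoulli product measure. -/
def forcing (lam : ℝ) (m : I) : ℝ :=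
  ∫ η, ((1 - occ η 0) * birthRate lam η 0 - occ η 0 * deathRate η 0) ∂bernoulliProduct ℤ m

section Torus

variable (n : ℕ) [NeZero n]

/-- The generator `L_n = n² L^{ex} + L^r` on the torus `ℤ/nℤ`. -/
def generator (lam : ℝ) : (Config (ZMod n) → ℝ) →ₗ[ℝ] (Config (ZMod n) → ℝ) where
  toFun g η := (n : ℝ) ^ 2 * (∑ x : ZMod n, (g (exchange η x (x + 1)) - g η)) +
    ∑ x : ZMod n, flipRate lam η x * (g (flip η x) - g η)
  map_add' g h := by
    funext η
    simp only [Pi.add_apply, Finset.mul_sum, ← Finset.sum_add_distrib]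
    refine Finset.sum_congr rfl fun x _ => ?_
    ring
  map_smul' a g := by
    funext η
    simp only [Pi.smul_apply, smul_eq_mul, RingHom.id_apply, Finset.mul_sum,
      ← Finset.sum_add_distrib]
    refine Finset.sum_congr rfl fun x _ => ?_
    ring

/-- The density fluctuation field `X^n(f)`, as a function of the configuration;
`ZMod.toAddCircle x` is the point `x / n` of `ℝ/ℤ`. -/
def fluctuation (ρ : I) (f : UnitAddCircle → ℝ) (η : Config (ZMod n)) : ℝ :=
  (Real.sqrt n)⁻¹ * ∑ x : ZMod n, f (ZMod.toAddCircle x) * (occ η x - ρ)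

/-- The reaction-diffusion process on `ℤ/nℤ` started from `ν_ρ`. -/
def IsReactionDiffusion (lam : ℝ) (ρ : I) {Ω : Type*} [MeasurableSpace Ω] (P : Measure Ω)
    (η : ℝ → Ω → Config (ZMod n)) : Prop :=
  IsMarkovProcess (generator n lam) (bernoulliProduct (ZMod n) ρ) P η

/-- The additive functional `∫_s^t L_n X^n_r(f) dr`. -/
def additiveFunctional (lam : ℝ) (ρ : I) (f : UnitAddCircle → ℝ) {Ω : Type*}
    (η : ℝ → Ω → Config (ZMod n)) (s t : ℝ) (ω : Ω) : ℝ :=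
  ∫ r in s..t, generator n lam (fluctuation n ρ f) (η r ω)

end Torus

/-- `C([0,T]; ℝ)`, with the uniform topology, carries its Borel σ-algebra. -/
instance pathMeasurableSpace (T : ℝ) : MeasurableSpace C(Set.Icc (0 : ℝ) T, ℝ) := borel _

instance pathBorelSpace (T : ℝ) : BorelSpace C(Set.Icc (0 : ℝ) T, ℝ) := ⟨rfl⟩

end ReactionDiffusion

end

noncomputable section

namespace ReactionDiffusion

/-! ### Product weights on a finite set of sites -/

section Weights

set_option linter.unusedSectionVars false

variable {G : Type*} [Fintype G] [DecidableEq G]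

/-! The difficulty is that the Bernoulli law is invariant for the exchanges but not for the
reaction, so the law of the process at time t is not explicit. The remedy is a bound, uniform in n,
of the mean of the evolved function by an `L^Q` norm of the initial one (`mean_semigroup_le`). It
reduces moments along the process to static moments under the product law.

The adjoint of the reaction applied to 1 is the function `potential`. Since F(ρ) = 0, its expansion
in centered occupation variables has no terms of degree 0 or 1: it is a sum of `pairing` at x times
the centered variable at x + 1. Replace this last factor by its average over the torus. The error is
a combination of nearest-neighbour gradients. Integrating these by parts (`mean_gradient_mul_le`)
costs half of the Dirichlet form, accelerated by n², plus squares of linear statistics. These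
squares, and those coming from the average, are of order n times entropy plus mass, by the entropy
inequality and sub-Gaussian concentration. All powers of n cancel, and the potential tested against
k² is at most half the accelerated Dirichlet form of k, plus K times the entropy of k², plus C times
its mass (`mean_potential_mul_le`).

As in Gross's argument for hypercontractivity, follow the `L^q` norm of the evolved function with
q(t) = Q exp(-Kt). The decrease of q produces minus K times the entropy, the dynamics produces minus
the Dirichlet form, and together they absorb the potential. The logarithm of the norm grows at most
at rate C.

The drift of the fluctuation field is n^(-1/2) times a sum of bounded local functions, centered
because F(ρ) = 0 and hence sub-Gaussian uniformly in n (`generator_fluctuation_bounds`). So all its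
moments are bounded along the process, and Jensen's inequality in time gives the first claim. For
tightness, the time integral of the squared drift controls all increments at once by Cauchy-Schwarz.
Markov's inequality then puts the paths, with high probability, in a compact set of 1/2-Hölder
functions. -/

/-- The mass of `b` under the Bernoulli law of parameter `p`. -/
def siteWeight (p : ℝ) (b : Bool) : ℝ := if b then p else 1 - p

/-- The mass of a configuration under the Bernoulli product law of density `p`. -/
def weight (p : ℝ) (η : Config G) : ℝ := ∏ x, siteWeight p (η x)

/-- The expectation of `g` under the Bernoulli product law of density `p`. -/
def mean (p : ℝ) (g : Config G → ℝ) : ℝ := ∑ η, weight p η * g η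

/-- The conditional expectation of `g` given all the sites but `x`. -/
def siteAvg (p : ℝ) (x : G) (g : Config G → ℝ) (η : Config G) : ℝ :=
  p * g (Function.update η x true) + (1 - p) * g (Function.update η x false)

lemma siteWeight_add_not (p : ℝ) (b : Bool) : siteWeight p b + siteWeight p (!b) = 1 := by
  cases b <;> simp [siteWeight]

lemma weight_update (p : ℝ) (η : Config G) (x : G) (b : Bool) :
    weight p (Function.update η x b) * siteWeight p (η x) = weight p η * siteWeight p b := by
  unfold weight
  rw [← Finset.mul_prod_erase _ _ (Finset.mem_univ x),
    ← Finset.mul_prod_erase _ (fun y => siteWeight p (η y)) (Finset.mem_univ x)]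
  have : ∏ y ∈ Finset.univ.erase x, siteWeight p (Function.update η x b y)
      = ∏ y ∈ Finset.univ.erase x, siteWeight p (η y) :=
    Finset.prod_congr rfl fun y hy => by
      rw [Function.update_of_ne (Finset.ne_of_mem_erase hy)]
  rw [this, Function.update_self]
  ring

lemma weight_flip (p : ℝ) (η : Config G) (x : G) :
    weight p (flip η x) * siteWeight p (η x) = weight p η * siteWeight p (!(η x)) :=
  weight_update p η x _

lemma flip_flip (η : Config G) (x : G) : flip (flip η x) x = η := by
  simp [flip]

lemma flip_apply_self (η : Config G) (x : G) : flip η x x = !(η x) := by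
  simp [flip]

lemma sum_flip (x : G) (F : Config G → ℝ) : ∑ η, F (flip η x) = ∑ η, F η :=
  Function.Involutive.bijective (fun η => flip_flip η x) |>.sum_comp F

lemma siteAvg_eq (p : ℝ) (x : G) (g : Config G → ℝ) (η : Config G) :
    siteAvg p x g η = siteWeight p (η x) * g η + siteWeight p (!(η x)) * g (flip η x) := by
  have h : Function.update η x (η x) = η := Function.update_eq_self x η
  unfold siteAvg flip
  cases hx : η x <;> rw [hx] at h <;> simp [siteWeight, h]
  ring

/-- The flip at x carries the term with the flipped configuration back to the original one,
exchanging the two site weights, and these add up to 1. -/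
lemma mean_siteAvg (p : ℝ) (x : G) (g : Config G → ℝ) : mean p (siteAvg p x g) = mean p g := by
  unfold mean
  simp only [siteAvg_eq, mul_add, Finset.sum_add_distrib]
  have h : ∑ η, weight p η * (siteWeight p (!(η x)) * g (flip η x))
      = ∑ η, weight p η * (siteWeight p (!(η x)) * g η) := by
    rw [← sum_flip x (fun η => weight p η * (siteWeight p (!(η x)) * g η))]
    refine Finset.sum_congr rfl fun η _ => ?_
    rw [flip_apply_self, Bool.not_not, ← mul_assoc, ← mul_assoc, weight_flip]
  rw [h, ← Finset.sum_add_distrib]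
  refine Finset.sum_congr rfl fun η _ => ?_
  linear_combination weight p η * g η * siteWeight_add_not p (η x)

lemma mean_add (p : ℝ) (g h : Config G → ℝ) :
    mean p (fun η => g η + h η) = mean p g + mean p h := by
  simp [mean, mul_add, Finset.sum_add_distrib]

lemma mean_sub (p : ℝ) (g h : Config G → ℝ) :
    mean p (fun η => g η - h η) = mean p g - mean p h := by
  simp [mean, mul_sub, Finset.sum_sub_distrib]

lemma mean_const_mul (p c : ℝ) (g : Config G → ℝ) :
    mean p (fun η => c * g η) = c * mean p g := by
  simp only [mean, Finset.mul_sum]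
  exact Finset.sum_congr rfl fun η _ => by ring

lemma mean_sum {ι : Type*} (p : ℝ) (s : Finset ι) (g : ι → Config G → ℝ) :
    mean p (fun η => ∑ i ∈ s, g i η) = ∑ i ∈ s, mean p (g i) := by
  simp only [mean, Finset.mul_sum]
  exact Finset.sum_comm

lemma sum_weight (p : ℝ) : ∑ η : Config G, weight p η = 1 := by
  have h := (Finset.prod_univ_sum (fun _ : G => (Finset.univ : Finset Bool))
    (fun _ b => siteWeight p b)).symm
  rw [Fintype.piFinset_univ] at h
  unfold weight
  rw [h]
  simp [siteWeight]

lemma mean_const (p c : ℝ) : mean p (fun _ : Config G => c) = c := by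
  rw [mean, ← Finset.sum_mul, sum_weight, one_mul]

variable {p : ℝ}

lemma siteWeight_pos (h0 : 0 < p) (h1 : p < 1) (b : Bool) : 0 < siteWeight p b := by
  cases b <;> simp [siteWeight, h0, h1]

lemma weight_pos (h0 : 0 < p) (h1 : p < 1) (η : Config G) : 0 < weight p η :=
  Finset.prod_pos fun _ _ => siteWeight_pos h0 h1 _

lemma mean_mono (h0 : 0 < p) (h1 : p < 1) {g h : Config G → ℝ} (hgh : ∀ η, g η ≤ h η) :
    mean p g ≤ mean p h :=
  Finset.sum_le_sum fun η _ => mul_le_mul_of_nonneg_left (hgh η) (weight_pos h0 h1 η).le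

lemma mean_pos (h0 : 0 < p) (h1 : p < 1) {g : Config G → ℝ} (hg : ∀ η, 0 < g η) :
    0 < mean p g :=
  Finset.sum_pos (fun η _ => mul_pos (weight_pos h0 h1 η) (hg η)) Finset.univ_nonempty

/-! ### Concentration -/

/-- Changing the value at one site changes `S` by at most `c`. -/
def BoundedDifferences (c : ℝ) (S : Config G → ℝ) : Prop :=
  ∀ η x, |S (Function.update η x true) - S (Function.update η x false)| ≤ c

/-- Symmetrization: let A be the exponential moment of the centered two-point variable and B that of
its negative. Then B ≥ 1, so A ≤ AB, and AB is the exponential moment of the difference of two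
independent copies, bounded by cosh(a - b). -/
lemma two_point_exp_le (h0 : 0 ≤ p) (h1 : p ≤ 1) (a b : ℝ) :
    p * Real.exp a + (1 - p) * Real.exp b
      ≤ Real.exp (p * a + (1 - p) * b + (a - b) ^ 2 / 2) := by
  set m := p * a + (1 - p) * b with hm
  have hq : 0 ≤ 1 - p := by linarith
  set A := p * Real.exp (a - m) + (1 - p) * Real.exp (b - m) with hA
  set B := p * Real.exp (m - a) + (1 - p) * Real.exp (m - b) with hB
  have hA0 : 0 ≤ A := by positivity
  have hB1 : 1 ≤ B := by
    have e1 := mul_le_mul_of_nonneg_left (Real.add_one_le_exp (m - a)) h0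
    have e2 := mul_le_mul_of_nonneg_left (Real.add_one_le_exp (m - b)) hq
    have e3 : p * (m - a + 1) + (1 - p) * (m - b + 1) = 1 := by rw [hm]; ring
    linarith
  have hAB : A * B = p ^ 2 + (1 - p) ^ 2 + 2 * p * (1 - p) * Real.cosh (a - b) := by
    have e1 : Real.exp (a - m) * Real.exp (m - a) = 1 := by rw [← Real.exp_add]; simp
    have e2 : Real.exp (b - m) * Real.exp (m - b) = 1 := by rw [← Real.exp_add]; simp
    have e3 : Real.exp (a - m) * Real.exp (m - b) = Real.exp (a - b) := by
      rw [← Real.exp_add]; ring_nf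
    have e4 : Real.exp (b - m) * Real.exp (m - a) = Real.exp (-(a - b)) := by
      rw [← Real.exp_add]; ring_nf
    rw [hA, hB, Real.cosh_eq]
    linear_combination p ^ 2 * e1 + (1 - p) ^ 2 * e2 + p * (1 - p) * e3 + p * (1 - p) * e4
  have hcosh : A ≤ Real.exp ((a - b) ^ 2 / 2) := by
    have h2 := Real.one_le_cosh (a - b)
    have h3 := Real.cosh_le_exp_half_sq (a - b)
    have h4 : A * 1 ≤ A * B := mul_le_mul_of_nonneg_left hB1 hA0
    have h5 : A * B ≤ Real.cosh (a - b) := by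
      rw [hAB]
      nlinarith [mul_nonneg h0 hq, sq_nonneg (1 - 2 * p)]
    linarith
  have hfac : p * Real.exp a + (1 - p) * Real.exp b = Real.exp m * A := by
    have e1 : Real.exp a = Real.exp m * Real.exp (a - m) := by rw [← Real.exp_add]; ring_nf
    have e2 : Real.exp b = Real.exp m * Real.exp (b - m) := by rw [← Real.exp_add]; ring_nf
    rw [e1, e2]; ring
  rw [hfac, Real.exp_add m]
  exact mul_le_mul_of_nonneg_left hcosh (Real.exp_pos _).le

/-- Away from x the difference is a convex combination of two differences of `S`; at x it vanishes.
-/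
lemma BoundedDifferences.siteAvg (h0 : 0 ≤ p) (h1 : p ≤ 1) {c : ℝ} {S : Config G → ℝ}
    (hS : BoundedDifferences c S) (x : G) : BoundedDifferences c (siteAvg p x S) := by
  intro η y
  have hq : 0 ≤ 1 - p := by linarith
  have hc : 0 ≤ c := (abs_nonneg _).trans (hS η x)
  unfold ReactionDiffusion.siteAvg
  rcases eq_or_ne y x with rfl | hxy
  · simpa using hc
  · rw [Function.update_comm hxy, Function.update_comm hxy, Function.update_comm hxy,
      Function.update_comm hxy]
    have e1 := abs_le.1 (hS (Function.update η x true) y)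
    have e2 := abs_le.1 (hS (Function.update η x false) y)
    rw [abs_le]
    constructor <;> nlinarith

/-- Induction on the sites that `S` may depend on. Averaging out one site costs a factor exp(s²c²/2)
by the two-point bound, and preserves both the mean and the bounded differences. -/
theorem mean_exp_le_of_dependsOn (h0 : 0 < p) (h1 : p < 1) {c : ℝ} (s : ℝ) (A : Finset G) :
    ∀ S : Config G → ℝ, BoundedDifferences c S →
      (∀ x ∉ A, ∀ η b, S (Function.update η x b) = S η) →
      mean p (fun η => Real.exp (s * S η))
        ≤ Real.exp (s ^ 2 * c ^ 2 * A.card / 2 + s * mean p S) := by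
  induction A using Finset.induction_on with
  | empty =>
    intro S _ hS
    have hconst : ∀ η, S η = S (fun _ => false) := by
      -- A function independent of every site is constant: the occupied sites, contained in `B`, are
      -- emptied one at a time.
      have key : ∀ (B : Finset G) (η : Config G), (∀ x ∉ B, η x = false) →
          S η = S (fun _ => false) := by
        intro B
        induction B using Finset.induction_on with
        | empty =>
          intro η hη
          congr 1
          ext x
          exact hη x (by simp)
        | insert a B _ ih =>
          intro η hη
          rw [← hS a (by simp) η false]
          refine ih _ fun x hx => ?_
          by_cases hxa : x = a
          · simp [hxa]
          · rw [Function.update_of_ne hxa]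
            exact hη x (by simp [hxa, hx])
      exact fun η => key Finset.univ η (by simp)
    have : S = fun _ => S (fun _ => false) := funext hconst
    rw [this]
    simp [mean_const]
  | insert a A ha ih =>
    intro S hbd hS
    have hstep : mean p (fun η => Real.exp (s * S η))
        ≤ mean p (fun η => Real.exp (s ^ 2 * c ^ 2 / 2) * Real.exp (s * siteAvg p a S η)) := by
      rw [← mean_siteAvg p a (fun η => Real.exp (s * S η))]
      refine mean_mono h0 h1 fun η => ?_
      refine (two_point_exp_le h0.le h1.le _ _).trans ?_
      rw [← Real.exp_add, Real.exp_le_exp]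
      have h2 : (S (Function.update η a true) - S (Function.update η a false)) ^ 2 ≤ c ^ 2 :=
        sq_le_sq' (abs_le.1 (hbd η a)).1 (abs_le.1 (hbd η a)).2
      have h3 := mul_le_mul_of_nonneg_left h2 (sq_nonneg s)
      unfold siteAvg
      nlinarith
    refine hstep.trans ?_
    rw [mean_const_mul]
    have h4 := ih (siteAvg p a S) (hbd.siteAvg h0.le h1.le a) (by
      intro x hx η b
      unfold siteAvg
      by_cases hxa : x = a
      · subst hxa; simp
      · rw [Function.update_comm hxa, Function.update_comm hxa,
          hS x (by simp [hxa, hx]), hS x (by simp [hxa, hx])])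
    rw [mean_siteAvg] at h4
    refine (mul_le_mul_of_nonneg_left h4 (Real.exp_pos _).le).trans ?_
    rw [← Real.exp_add, Finset.card_insert_of_notMem ha]
    refine Real.exp_le_exp.2 (le_of_eq ?_)
    push_cast
    ring

/-- The bounded differences inequality. -/
theorem mean_exp_le (h0 : 0 < p) (h1 : p < 1) {c : ℝ} {S : Config G → ℝ}
    (hS : BoundedDifferences c S) (hmean : mean p S = 0) (s : ℝ) :
    mean p (fun η => Real.exp (s * S η)) ≤ Real.exp (s ^ 2 * c ^ 2 * Fintype.card G / 2) := by
  have := mean_exp_le_of_dependsOn h0 h1 (c := c) s Finset.univ S hS (by simp)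
  simpa [hmean] using this

/-- Completing the square. The formula writes the exponential of a square as a Gaussian average of
exponentials of linear terms. -/
lemma integral_exp_mul_sub_sq (a : ℝ) :
    Integrable (fun z : ℝ => Real.exp (a * z - z ^ 2 / 2)) ∧
      ∫ z : ℝ, Real.exp (a * z - z ^ 2 / 2) = Real.sqrt (2 * Real.pi) * Real.exp (a ^ 2 / 2) := by
  have e : (fun z : ℝ => Real.exp (a * z - z ^ 2 / 2))
      = fun z => Real.exp (a ^ 2 / 2) * Real.exp (-(1 / 2) * (z - a) ^ 2) := by
    funext z
    rw [← Real.exp_add]; ring_nf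
  rw [e]
  constructor
  · exact ((integrable_exp_neg_mul_sq (by norm_num : (0 : ℝ) < 1 / 2)).comp_sub_right a).const_mul _
  · rw [integral_const_mul, integral_sub_right_eq_self (fun z => Real.exp (-(1 / 2) * z ^ 2)) a,
      integral_gaussian, mul_comm]
    congr 2
    ring

/-- Exponential moments of the square of a function with bounded differences. -/
theorem mean_exp_sq_le (h0 : 0 < p) (h1 : p < 1) {c κ : ℝ} {S : Config G → ℝ}
    (hS : BoundedDifferences c S) (hmean : mean p S = 0) (hκ : 0 ≤ κ)
    (hκc : 4 * κ * c ^ 2 * Fintype.card G ≤ 1) :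
    mean p (fun η => Real.exp (κ * S η ^ 2)) ≤ 2 := by
  set a := Real.sqrt (2 * κ) with ha
  have ha2 : a ^ 2 = 2 * κ := Real.sq_sqrt (by linarith)
  have hπ : 0 < Real.sqrt (2 * Real.pi) := Real.sqrt_pos.2 (by positivity)
  have hgauss : ∀ η, Real.sqrt (2 * Real.pi) * Real.exp (κ * S η ^ 2)
      = ∫ z : ℝ, Real.exp (a * S η * z - z ^ 2 / 2) := fun η => by
    rw [(integral_exp_mul_sub_sq _).2, mul_pow, ha2]
    ring_nf
  have hswap : Real.sqrt (2 * Real.pi) * mean p (fun η => Real.exp (κ * S η ^ 2))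
      = ∫ z : ℝ, mean p (fun η => Real.exp ((a * z) * S η)) * Real.exp (-z ^ 2 / 2) := by
    rw [← mean_const_mul]
    simp only [hgauss, mean, Finset.sum_mul]
    rw [integral_finsetSum]
    · refine Finset.sum_congr rfl fun η _ => ?_
      rw [← integral_const_mul]
      congr 1
      funext z
      rw [mul_assoc (weight p η), ← Real.exp_add]
      ring_nf
    · intro η _
      have := ((integral_exp_mul_sub_sq (a * S η)).1).const_mul (weight p η)
      refine this.congr (ae_of_all _ fun z => ?_)
      simp only [mul_assoc, ← Real.exp_add]
      ring_nf
  -- The linear exponential moment contributes exp(κc²|G|z²) ≤ exp(z²/4), leaving exp(-z²/4) to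
  -- integrate; the resulting constant √2 is rounded up to 2.
  have hle : ∫ z : ℝ, mean p (fun η => Real.exp ((a * z) * S η)) * Real.exp (-z ^ 2 / 2)
      ≤ ∫ z : ℝ, Real.exp (-(1 / 4) * z ^ 2) := by
    refine integral_mono_of_nonneg (ae_of_all _ fun z => ?_)
      (integrable_exp_neg_mul_sq (by norm_num)) (ae_of_all _ fun z => ?_)
    · exact mul_nonneg (mean_pos h0 h1 fun η => Real.exp_pos _).le (Real.exp_pos _).le
    · refine (mul_le_mul_of_nonneg_right (mean_exp_le h0 h1 hS hmean _)
        (Real.exp_pos _).le).trans ?_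
      rw [← Real.exp_add]
      refine Real.exp_le_exp.2 ?_
      rw [mul_pow, ha2]
      nlinarith [mul_le_mul_of_nonneg_right hκc (sq_nonneg z)]
  rw [integral_gaussian] at hle
  have hs : Real.sqrt (Real.pi / (1 / 4)) = Real.sqrt 2 * Real.sqrt (2 * Real.pi) := by
    rw [← Real.sqrt_mul (by norm_num)]
    congr 1
    ring
  have h2 : Real.sqrt 2 ≤ 2 := by
    rw [Real.sqrt_le_left (by norm_num)]; norm_num
  rw [← hswap, hs] at hle
  have := le_of_mul_le_mul_left (hle.trans_eq (mul_comm _ _)) hπ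
  linarith

/-! ### Entropy -/

/-- The entropy of `h` under the Bernoulli product law. -/
def entropy (p : ℝ) (h : Config G → ℝ) : ℝ :=
  mean p (fun η => h η * Real.log (h η)) - mean p h * Real.log (mean p h)

/-- Young's inequality for the Legendre pair a log a - a and exp b, from 1 + x ≤ exp x at x = b -
log a. -/
lemma mul_le_mul_log_add_exp {a : ℝ} (ha : 0 < a) (b : ℝ) :
    a * b ≤ a * Real.log a - a + Real.exp b := by
  have h := Real.add_one_le_exp (b - Real.log a)
  rw [Real.exp_sub, Real.exp_log ha, le_div_iff₀ ha] at h
  linarith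

/-- The entropy inequality. -/
theorem mean_mul_le_entropy (h0 : 0 < p) (h1 : p < 1) {h W : Config G → ℝ} (hh : ∀ η, 0 < h η) :
    mean p (fun η => h η * W η)
      ≤ entropy p h + mean p h * Real.log (mean p (fun η => Real.exp (W η))) := by
  set Φ := mean p h with hΦ
  set Z := mean p (fun η => Real.exp (W η)) with hZ
  have hΦ0 : 0 < Φ := mean_pos h0 h1 hh
  have hZ0 : 0 < Z := mean_pos h0 h1 fun η => Real.exp_pos _
  -- Young's inequality for the normalized density h/Φ and the normalized exponent W - log Z,
  -- multiplied by Φ.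
  have hpt : ∀ η, h η * W η ≤ h η * Real.log (h η) + (Real.log Z - Real.log Φ - 1) * h η
      + Φ / Z * Real.exp (W η) := by
    intro η
    have e := mul_le_mul_log_add_exp (div_pos (hh η) hΦ0) (W η - Real.log Z)
    rw [Real.log_div (hh η).ne' hΦ0.ne', Real.exp_sub, Real.exp_log hZ0] at e
    have e2 := mul_le_mul_of_nonneg_left e hΦ0.le
    have e3 : Φ * (h η / Φ * (W η - Real.log Z)) = h η * W η - h η * Real.log Z := by
      field_simp
    have e4 : Φ * (h η / Φ * (Real.log (h η) - Real.log Φ) - h η / Φ + Real.exp (W η) / Z)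
        = h η * Real.log (h η) - Real.log Φ * h η - h η + Φ / Z * Real.exp (W η) := by
      field_simp
    rw [e3, e4] at e2
    linarith
  have := mean_mono h0 h1 hpt
  rw [mean_add, mean_add, mean_const_mul, mean_const_mul, ← hZ, ← hΦ,
    div_mul_cancel₀ _ hZ0.ne'] at this
  unfold entropy
  rw [← hΦ]
  linarith

/-- The entropy inequality with W = κS², whose exponential moment is at most 2. With κ of order 1/n
it bounds squares of sums over the torus by n times entropy plus mass. -/
theorem mean_mul_sq_le_entropy (h0 : 0 < p) (h1 : p < 1) {c κ : ℝ} {h S : Config G → ℝ}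
    (hh : ∀ η, 0 < h η) (hS : BoundedDifferences c S) (hmean : mean p S = 0) (hκ : 0 ≤ κ)
    (hκc : 4 * κ * c ^ 2 * Fintype.card G ≤ 1) :
    κ * mean p (fun η => h η * S η ^ 2) ≤ entropy p h + mean p h * Real.log 2 := by
  have e1 := mean_mul_le_entropy h0 h1 (W := fun η => κ * S η ^ 2) hh
  have e2 := mean_exp_sq_le h0 h1 hS hmean hκ hκc
  have e3 : Real.log (mean p (fun η => Real.exp (κ * S η ^ 2))) ≤ Real.log 2 :=
    Real.log_le_log (mean_pos h0 h1 fun η => Real.exp_pos _) e2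
  have e4 := mul_le_mul_of_nonneg_left e3 (mean_pos h0 h1 hh).le
  have e5 : mean p (fun η => h η * (κ * S η ^ 2)) = κ * mean p (fun η => h η * S η ^ 2) := by
    rw [← mean_const_mul]
    congr 1
    funext η
    ring
  rw [e5] at e1
  linarith

end Weights

/-! ### The Bernoulli product measure -/

section Bernoulli

lemma bernoulliMeasure_real_singleton (ρ : I) (b : Bool) :
    (bernoulliMeasure true false ρ).real {b} = siteWeight ρ b := by
  cases b <;> simp [siteWeight]

lemma bernoulliProduct_real_singleton {G : Type*} [Fintype G] (ρ : I) (η : Config G) :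
    (bernoulliProduct G ρ).real {η} = weight ρ η := by
  unfold bernoulliProduct weight
  rw [measureReal_def, Measure.infinitePi_singleton_of_fintype, ENNReal.toReal_prod]
  exact Finset.prod_congr rfl fun x _ => bernoulliMeasure_real_singleton ρ (η x)

instance isProbabilityMeasure_bernoulliProduct {G : Type*} (ρ : I) :
    IsProbabilityMeasure (bernoulliProduct G ρ) := by
  unfold bernoulliProduct
  infer_instance

lemma integral_bernoulliProduct {G : Type*} [Fintype G] [DecidableEq G] (ρ : I)
    (g : Config G → ℝ) : ∫ η, g η ∂bernoulliProduct G ρ = mean (ρ : ℝ) g := by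
  rw [integral_fintype (Integrable.of_finite)]
  exact Finset.sum_congr rfl fun η _ => by rw [bernoulliProduct_real_singleton, smul_eq_mul]

/-- The product is the indicator of a cylinder event; `G` may be infinite, as needed for `forcing`
on ℤ. -/
lemma integral_prod_occ {G : Type*} (ρ : I) (s : Finset G) :
    Integrable (fun η : Config G => ∏ x ∈ s, occ η x) (bernoulliProduct G ρ) ∧
    ∫ η, ∏ x ∈ s, occ η x ∂bernoulliProduct G ρ = (ρ : ℝ) ^ s.card := by
  classical
  have hm : MeasurableSet (Set.pi (s : Set G) fun _ => ({true} : Set Bool)) :=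
    MeasurableSet.pi s.countable_toSet fun _ _ => measurableSet_singleton _
  have h : (fun η : Config G => ∏ x ∈ s, occ η x)
      = (Set.pi (s : Set G) fun _ => ({true} : Set Bool)).indicator 1 := by
    funext η
    unfold occ
    rw [Finset.prod_ite_zero, Set.indicator_apply]
    simp [Set.mem_pi]
  rw [h]
  refine ⟨(integrable_const (1 : ℝ)).indicator hm, ?_⟩
  rw [integral_indicator_one hm, measureReal_def]
  unfold bernoulliProduct
  rw [Measure.infinitePi_pi _ (fun _ _ => measurableSet_singleton _), ENNReal.toReal_prod,
    Finset.prod_eq_pow_card]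
  exact fun x _ => (bernoulliMeasure_real_singleton ρ true).trans (by simp [siteWeight])

lemma forcing_eq (lam : ℝ) (m : I) :
    forcing lam m = (1 - m) * (1 + lam * (m : ℝ) ^ 2) - m := by
  have h0 := integral_prod_occ (G := ℤ) m {0}
  have h2 := integral_prod_occ (G := ℤ) m {-1, 1}
  have h3 := integral_prod_occ (G := ℤ) m {-1, 0, 1}
  have e : ∀ η : Config ℤ, (1 - occ η 0) * birthRate lam η 0 - occ η 0 * deathRate η 0
      = 1 - 2 * (∏ x ∈ {0}, occ η x) + lam * (∏ x ∈ {-1, 1}, occ η x)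
        - lam * (∏ x ∈ {-1, 0, 1}, occ η x) := by
    intro η
    rw [Finset.prod_insert (by decide), Finset.prod_insert (by decide),
      Finset.prod_insert (by decide)]
    simp only [birthRate, deathRate, Finset.prod_singleton, zero_sub, zero_add]
    ring
  unfold forcing
  simp_rw [e]
  rw [integral_sub, integral_add, integral_sub, integral_const_mul, integral_const_mul,
    integral_const_mul, h0.2, h2.2, h3.2]
  · have c2 : ({-1, 1} : Finset ℤ).card = 2 := by decide
    have c3 : ({-1, 0, 1} : Finset ℤ).card = 3 := by decide
    rw [c2, c3]
    simp
    ring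
  all_goals first
    | exact integrable_const _
    | exact h0.1.const_mul _
    | exact h2.1.const_mul _
    | exact h3.1.const_mul _
    | exact (integrable_const _).sub (h0.1.const_mul _)
    | exact ((integrable_const _).sub (h0.1.const_mul _)).add (h2.1.const_mul _)

end Bernoulli

/-! ### Local functions on the torus -/

section LocalFunctions

variable {n : ℕ}

lemma one_ne_zero_zmod (hn : 3 ≤ n) : (1 : ZMod n) ≠ 0 := by
  have := (ZMod.natCast_eq_zero_iff 1 n).not.2 (fun h => by have := Nat.le_of_dvd one_pos h; omega)
  simpa using this

lemma two_ne_zero_zmod (hn : 3 ≤ n) : (1 + 1 : ZMod n) ≠ 0 := by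
  have := (ZMod.natCast_eq_zero_iff 2 n).not.2 (fun h => by have := Nat.le_of_dvd two_pos h; omega)
  simpa [one_add_one_eq_two] using this

lemma sub_one_ne (hn : 3 ≤ n) (x : ZMod n) : x - 1 ≠ x := by
  simpa using one_ne_zero_zmod hn

lemma add_one_ne (hn : 3 ≤ n) (x : ZMod n) : x + 1 ≠ x := by
  simpa using one_ne_zero_zmod hn

lemma sub_one_ne_add_one (hn : 3 ≤ n) (x : ZMod n) : x - 1 ≠ x + 1 := by
  intro h
  refine two_ne_zero_zmod hn ?_
  linear_combination -h

variable [NeZero n]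

/-- The mean of a function of three consecutive sites. -/
lemma mean_three_sites (hn : 3 ≤ n) (p : ℝ) (x : ZMod n) (F : Bool → Bool → Bool → ℝ) :
    mean p (fun η : Config (ZMod n) => F (η (x - 1)) (η x) (η (x + 1)))
      = ∑ a, ∑ b, ∑ c, siteWeight p a * siteWeight p b * siteWeight p c * F a b c := by
  have h1 := sub_one_ne hn x
  have h2 := add_one_ne hn x
  have h3 := sub_one_ne_add_one hn x
  -- For n ≥ 3 the three sites are distinct, so they can be averaged out separately.
  rw [← mean_siteAvg p (x - 1), ← mean_siteAvg p x, ← mean_siteAvg p (x + 1)]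
  unfold siteAvg
  simp only [Function.update_self, Function.update_of_ne h2, Function.update_of_ne h1.symm,
    Function.update_of_ne h3.symm]
  rw [mean_const]
  simp [siteWeight]
  ring

/-- Sums of bounded functions of three consecutive sites have bounded differences. -/
lemma boundedDifferences_three_sites {B : ℝ} (F : ZMod n → Bool → Bool → Bool → ℝ)
    (hF : ∀ x a b c, |F x a b c| ≤ B) :
    BoundedDifferences (6 * B)
      (fun η : Config (ZMod n) => ∑ x, F x (η (x - 1)) (η x) (η (x + 1))) := by
  intro η y
  rw [← Finset.sum_sub_distrib]
  have hB : 0 ≤ B := (abs_nonneg _).trans (hF 0 true true true)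
  -- The site y enters only the terms x = y + 1, y, y - 1, each moving by at most 2B. The indicators
  -- are added, so coincidences on small tori do no harm.
  have hterm : ∀ x : ZMod n,
      |F x (Function.update η y true (x - 1)) (Function.update η y true x)
          (Function.update η y true (x + 1))
        - F x (Function.update η y false (x - 1)) (Function.update η y false x)
          (Function.update η y false (x + 1))|
      ≤ 2 * B * ((if x = y + 1 then 1 else 0) + (if x = y then 1 else 0)
          + (if x = y - 1 then 1 else 0)) := by
    intro x
    by_cases hx : x = y + 1 ∨ x = y ∨ x = y - 1
    · have h1 : (1 : ℝ) ≤ (if x = y + 1 then 1 else 0) + (if x = y then 1 else 0)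
          + (if x = y - 1 then 1 else 0) := by
        rcases hx with h | h | h <;> rw [if_pos h] <;> split_ifs <;> norm_num
      refine (abs_sub _ _).trans ?_
      have h2 := hF x (Function.update η y true (x - 1)) (Function.update η y true x)
          (Function.update η y true (x + 1))
      have h3 := hF x (Function.update η y false (x - 1)) (Function.update η y false x)
          (Function.update η y false (x + 1))
      nlinarith
    · push Not at hx
      have h1 : x - 1 ≠ y := fun h => hx.1 (by rw [← h]; ring)
      have h2 : x + 1 ≠ y := fun h => hx.2.2 (by rw [← h]; ring)
      simp [Function.update_of_ne h1, Function.update_of_ne h2, hx.1, hx.2.1, hx.2.2]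
  refine (Finset.abs_sum_le_sum_abs _ _).trans ((Finset.sum_le_sum fun x _ => hterm x).trans ?_)
  rw [← Finset.mul_sum, Finset.sum_add_distrib, Finset.sum_add_distrib]
  simp only [Finset.sum_ite_eq', Finset.mem_univ, if_true]
  linarith

lemma sum_zmod_eq_sum_range (H : ZMod n → ℝ) : ∑ z, H z = ∑ j ∈ Finset.range n, H (j : ZMod n) := by
  refine Finset.sum_bij' (fun z _ => z.val) (fun j _ => (j : ZMod n)) ?_ ?_ ?_ ?_ ?_
  · exact fun z _ => Finset.mem_range.2 z.val_lt
  · simp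
  · intro z _; simp
  · intro j hj; exact ZMod.val_cast_of_lt (Finset.mem_range.1 hj)
  · intro z _; simp

/-- The coefficients that write the difference of a local value and the spatial average as a
combination of gradients. -/
def gradientWeight (z : ZMod n) : ℝ := 1 - ((z.val : ℝ) + 1) / n

lemma gradientWeight_mem (z : ZMod n) : 0 ≤ gradientWeight z ∧ gradientWeight z ≤ 1 := by
  have hn : (0 : ℝ) < n := Nat.cast_pos.2 (NeZero.pos n)
  have h : ((z.val : ℝ) + 1) ≤ n := by exact_mod_cast z.val_lt
  unfold gradientWeight
  constructor
  · rw [sub_nonneg, div_le_one hn]; exact h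
  · have : 0 ≤ ((z.val : ℝ) + 1) / n := by positivity
    linarith

/-- Summation by parts once around the torus. The weight vanishes at the last step, so the gradient
that closes the cycle does not contribute. -/
lemma sub_average_eq_sum_gradient (F : ZMod n → ℝ) (x : ZMod n) :
    F x - (∑ y, F y) / n = ∑ z, gradientWeight z * (F (x + z) - F (x + z + 1)) := by
  have hn : (n : ℝ) ≠ 0 := Nat.cast_ne_zero.2 (NeZero.ne n)
  have key : ∀ (c : ℕ → ℝ) (k : ℕ),
      ∑ j ∈ Finset.range k, ((n : ℝ) - (j + 1)) * (c j - c (j + 1))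
        = n * c 0 - ∑ j ∈ Finset.range k, c j - (n - k) * c k := by
    intro c k
    induction k with
    | zero => simp
    | succ k ih =>
      rw [Finset.sum_range_succ, Finset.sum_range_succ, ih]
      push_cast
      ring
  have h1 : ∑ y, F y = ∑ j ∈ Finset.range n, F (x + (j : ZMod n)) := by
    rw [← sum_zmod_eq_sum_range (fun z => F (x + z))]
    exact (Equiv.sum_comp (Equiv.addLeft x) F).symm
  have h2 := key (fun j => F (x + (j : ZMod n))) n
  rw [h1, sum_zmod_eq_sum_range]
  simp only [sub_self, zero_mul, sub_zero, Nat.cast_zero, add_zero] at h2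
  have h3 : ∑ j ∈ Finset.range n, gradientWeight (j : ZMod n)
        * (F (x + (j : ZMod n)) - F (x + (j : ZMod n) + 1))
      = (∑ j ∈ Finset.range n, ((n : ℝ) - (j + 1))
        * (F (x + (j : ZMod n)) - F (x + ((j + 1 : ℕ) : ZMod n)))) / n := by
    rw [Finset.sum_div]
    refine Finset.sum_congr rfl fun j hj => ?_
    unfold gradientWeight
    rw [ZMod.val_cast_of_lt (Finset.mem_range.1 hj)]
    push_cast
    rw [← add_assoc]
    field_simp
  rw [h3, h2]
  field_simp

/-- The gradient weights away from `-1`, `-2`, `-3`. -/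
def innerWeight (z : ZMod n) : ℝ :=
  if z = -1 ∨ z = -2 ∨ z = -3 then 0 else gradientWeight z

lemma abs_innerWeight_le (z : ZMod n) : |innerWeight z| ≤ 1 := by
  unfold innerWeight
  have := gradientWeight_mem z
  split_ifs
  · simp
  · rw [abs_le]; constructor <;> linarith

/-- The removed points are the last three of the cycle, where the gradient weight has dropped to at
most 2/n. -/
lemma abs_gradientWeight_sub_innerWeight_le (z : ZMod n) :
    |gradientWeight z - innerWeight z| ≤ 2 / n * ((if z = -1 then 1 else 0)
      + (if z = -2 then 1 else 0) + (if z = -3 then 1 else 0)) := by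
  have hn : (0 : ℝ) < n := Nat.cast_pos.2 (NeZero.pos n)
  unfold innerWeight
  by_cases hz : z = -1 ∨ z = -2 ∨ z = -3
  · have h1 : (1 : ℝ) ≤ (if z = -1 then 1 else 0) + (if z = -2 then 1 else 0)
          + (if z = -3 then 1 else 0) := by
      rcases hz with h | h | h <;> rw [if_pos h] <;> split_ifs <;> norm_num
    have h2 : (n : ℝ) ≤ z.val + 3 := by
      have : ∃ k : ℕ, 1 ≤ k ∧ k ≤ 3 ∧ ((z.val + k : ℕ) : ZMod n) = 0 := by
        rcases hz with h | h | h
        · exact ⟨1, by norm_num, by norm_num, by simp [h]⟩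
        · exact ⟨2, by norm_num, by norm_num, by simp [h]⟩
        · exact ⟨3, by norm_num, by norm_num, by simp [h]⟩
      obtain ⟨k, hk1, hk3, hk⟩ := this
      have := Nat.le_of_dvd (by omega) ((ZMod.natCast_eq_zero_iff _ _).1 hk)
      have h3 : n ≤ z.val + 3 := by omega
      exact_mod_cast h3
    have h3 : gradientWeight z ≤ 2 / n := by
      unfold gradientWeight
      rw [le_div_iff₀ hn, sub_mul, div_mul_cancel₀ _ hn.ne']
      linarith
    rw [if_pos hz, sub_zero, abs_of_nonneg (gradientWeight_mem z).1]
    refine h3.trans ?_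
    have : 0 ≤ 2 / (n : ℝ) := by positivity
    nlinarith
  · rw [if_neg hz, sub_self, abs_zero]
    positivity

end LocalFunctions

/-! ### The reaction potential -/

section Potential

set_option linter.unusedSectionVars false

variable {n : ℕ} [NeZero n] {p lam : ℝ}

/-- The centered occupation variable. -/
def centered {G : Type*} (p : ℝ) (η : Config G) (x : G) : ℝ := occ η x - p

/-- The local function that multiplies the centered variable at `x + 1` in the potential. -/
def pairing (lam p : ℝ) (η : Config (ZMod n)) (x : ZMod n) : ℝ :=
  2 * lam * centered p η x + lam / p * (centered p η (x - 1) * centered p η x)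

/-- The adjoint in `L²` of the Bernoulli product law of the reaction part of the generator, applied
to the constant `1`. -/
def potential (lam p : ℝ) (η : Config (ZMod n)) : ℝ :=
  ∑ x, pairing lam p η x * centered p η (x + 1)

lemma occ_mem {G : Type*} (η : Config G) (x : G) : occ η x = 0 ∨ occ η x = 1 := by
  unfold occ; split_ifs <;> simp

lemma abs_centered_le {G : Type*} (h0 : 0 < p) (h1 : p < 1) (η : Config G) (x : G) :
    |centered p η x| ≤ 1 := by
  unfold centered
  rcases occ_mem η x with h | h <;> rw [h, abs_le] <;> constructor <;> linarith

lemma abs_pairing_le (hlam : 0 < lam) (h0 : 0 < p) (h1 : p < 1) (η : Config (ZMod n))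
    (x : ZMod n) : |pairing lam p η x| ≤ 2 * lam + lam / p := by
  have e1 := abs_centered_le h0 h1 η x
  have e2 := abs_centered_le h0 h1 η (x - 1)
  have e3 : |centered p η (x - 1) * centered p η x| ≤ 1 := by
    rw [abs_mul]; exact mul_le_one₀ e2 (abs_nonneg _) e1
  have hd : 0 < lam / p := by positivity
  unfold pairing
  refine (abs_add_le _ _).trans (add_le_add ?_ ?_)
  · rw [abs_mul, abs_of_pos (by positivity : 0 < 2 * lam)]
    nlinarith
  · rw [abs_mul, abs_of_pos hd]
    nlinarith

lemma mean_sum_centered (hn : 3 ≤ n) (p : ℝ) :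
    mean p (fun η : Config (ZMod n) => ∑ x, centered p η x) = 0 := by
  rw [mean_sum]
  refine Finset.sum_eq_zero fun x _ => ?_
  refine (mean_three_sites hn p x (fun _ b _ => (if b then 1 else 0) - p)).trans ?_
  simp [siteWeight]
  ring

lemma mean_sum_mul_pairing (hn : 3 ≤ n) (lam p : ℝ) (a : ZMod n → ℝ) :
    mean p (fun η : Config (ZMod n) => ∑ x, a x * pairing lam p η x) = 0 := by
  rw [mean_sum]
  refine Finset.sum_eq_zero fun x _ => ?_
  refine (mean_three_sites hn p x (fun b c _ => a x * (2 * lam * ((if c then 1 else 0) - p)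
    + lam / p * (((if b then 1 else 0) - p) * ((if c then 1 else 0) - p))))).trans ?_
  simp [siteWeight]
  ring

lemma boundedDifferences_sum_centered (h0 : 0 < p) (h1 : p < 1) :
    BoundedDifferences (6 * 1) (fun η : Config (ZMod n) => ∑ x, centered p η x) :=
  boundedDifferences_three_sites (fun _ _ b _ => (if b then 1 else 0) - p) fun _ _ b _ =>
    abs_centered_le h0 h1 (fun _ : Unit => b) ()

lemma boundedDifferences_sum_mul_pairing (hlam : 0 < lam) (h0 : 0 < p) (h1 : p < 1)
    {a : ZMod n → ℝ} (ha : ∀ x, |a x| ≤ 1) :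
    BoundedDifferences (6 * (2 * lam + lam / p))
      (fun η : Config (ZMod n) => ∑ x, a x * pairing lam p η x) := by
  refine boundedDifferences_three_sites (fun x b c _ => a x * (2 * lam * ((if c then 1 else 0) - p)
    + lam / p * (((if b then 1 else 0) - p) * ((if c then 1 else 0) - p)))) fun x b c _ => ?_
  have hd : 0 < lam / p := by positivity
  have e1 := abs_centered_le h0 h1 (fun _ : Unit => c) ()
  have e2 := abs_centered_le h0 h1 (fun _ : Unit => b) ()
  change |(if c then (1 : ℝ) else 0) - p| ≤ 1 at e1
  change |(if b then (1 : ℝ) else 0) - p| ≤ 1 at e2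
  set C := (if c then (1 : ℝ) else 0) - p
  set B := (if b then (1 : ℝ) else 0) - p
  have e3 : |B * C| ≤ 1 := by
    rw [abs_mul]; exact mul_le_one₀ e2 (abs_nonneg _) e1
  have e4 : |2 * lam * C + lam / p * (B * C)| ≤ 2 * lam + lam / p := by
    refine (abs_add_le _ _).trans (add_le_add ?_ ?_)
    · rw [abs_mul, abs_of_pos (by positivity : 0 < 2 * lam)]
      nlinarith
    · rw [abs_mul, abs_of_pos hd]
      nlinarith
  rw [abs_mul]
  calc |a x| * |2 * lam * C + lam / p * (B * C)| ≤ 1 * (2 * lam + lam / p) :=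
        mul_le_mul (ha x) e4 (abs_nonneg _) zero_le_one
    _ = _ := one_mul _

/-- Duality for the reaction part of the generator. -/
lemma mean_reaction (hn : 3 ≤ n) (h0 : 0 < p) (h1 : p < 1)
    (hF : (1 - p) * (1 + lam * p ^ 2) - p = 0) (h : Config (ZMod n) → ℝ) :
    mean p (fun η => ∑ x, flipRate lam η x * (h (flip η x) - h η))
      = mean p (fun η => potential lam p η * h η) := by
  -- The contribution of a reaction at x is (λ/p) times the centered variable at x times
  -- η_{x-1}η_{x+1} - p², expanded in centered variables. Its two quadratic terms agree after a
  -- translation, whence the factor 2λ in `pairing`.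
  have hpot : ∀ η : Config (ZMod n), potential lam p η = ∑ x, lam / p * (centered p η x
      * (p * (centered p η (x - 1) + centered p η (x + 1))
        + centered p η (x - 1) * centered p η (x + 1))) := by
    intro η
    have hs : ∑ x, lam * (centered p η (x - 1) * centered p η x)
        = ∑ x, lam * (centered p η x * centered p η (x + 1)) := by
      rw [← Equiv.sum_comp (Equiv.addRight (1 : ZMod n))]
      simp
    have e : ∀ x, lam / p * (centered p η x * (p * (centered p η (x - 1) + centered p η (x + 1))
          + centered p η (x - 1) * centered p η (x + 1)))
        = lam * (centered p η (x - 1) * centered p η x)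
          + (lam * (centered p η x * centered p η (x + 1))
          + lam / p * (centered p η (x - 1) * centered p η x) * centered p η (x + 1)) := by
      intro x; field_simp; ring
    simp only [e, Finset.sum_add_distrib]
    rw [hs]
    unfold potential pairing
    rw [← Finset.sum_add_distrib, ← Finset.sum_add_distrib]
    refine Finset.sum_congr rfl fun x _ => ?_
    ring
  simp only [hpot, Finset.sum_mul]
  rw [mean_sum, mean_sum]
  refine Finset.sum_congr rfl fun x _ => ?_
  unfold mean
  have e1 : ∀ η : Config (ZMod n), weight p η * (flipRate lam η x * (h (flip η x) - h η))
      = weight p η * flipRate lam η x * h (flip η x) - weight p η * flipRate lam η x * h η := by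
    intro η; ring
  simp only [e1, Finset.sum_sub_distrib]
  rw [← sum_flip x (fun η => weight p η * flipRate lam η x * h (flip η x)),
    ← Finset.sum_sub_distrib]
  refine Finset.sum_congr rfl fun η _ => ?_
  have hw := weight_flip p η x
  have hp : (1 - p) ≠ 0 := by linarith
  have o1 : occ (flip η x) (x - 1) = occ η (x - 1) := by
    unfold occ flip; rw [Function.update_of_ne (sub_one_ne hn x)]
  have o2 : occ (flip η x) (x + 1) = occ η (x + 1) := by
    unfold occ flip; rw [Function.update_of_ne (add_one_ne hn x)]
  have o3 : occ (flip η x) x = 1 - occ η x := by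
    unfold occ flip; rw [Function.update_self]; cases η x <;> simp
  rw [flip_flip, ← sub_mul, ← mul_assoc (weight p η)]
  congr 1
  unfold flipRate birthRate deathRate centered
  rw [o1, o2, o3]
  set A := occ η (x - 1)
  set B := occ η (x + 1)
  -- At each value of η_x the identity reduces to p = (1 - p)(1 + λp²), that is F(p) = 0: births and
  -- deaths balance on average.
  cases hx : η x
  · have o : occ η x = 0 := by simp [occ, hx]
    rw [hx] at hw
    simp [siteWeight] at hw
    rw [o]
    refine mul_left_cancel₀ hp ?_
    have hlp : lam / p * p = lam := div_mul_cancel₀ _ h0.ne'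
    linear_combination hw - weight p η * hF + (1 - p) * weight p η * (A * B - p ^ 2) * hlp
  · have o : occ η x = 1 := by simp [occ, hx]
    rw [hx] at hw
    simp [siteWeight] at hw
    rw [o]
    field_simp
    linear_combination (1 + lam * (A * B)) * hw + weight p η * hF

/-! ### Integration by parts for the exchange dynamics -/

lemma weight_exchange (p : ℝ) (η : Config (ZMod n)) (x y : ZMod n) :
    weight p (exchange η x y) = weight p η :=
  Equiv.prod_comp (Equiv.swap x y) (fun z => siteWeight p (η z))

lemma exchange_exchange (η : Config (ZMod n)) (x y : ZMod n) :
    exchange (exchange η x y) x y = η := by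
  funext z; simp [exchange]

lemma mean_exchange (p : ℝ) (x y : ZMod n) (F : Config (ZMod n) → ℝ) :
    mean p (fun η => F (exchange η x y)) = mean p F := by
  unfold mean
  rw [← Function.Bijective.sum_comp (Function.Involutive.bijective
    (f := fun η : Config (ZMod n) => exchange η x y) (fun η => exchange_exchange η x y)) (fun η => weight p η * F η)]
  simp only [weight_exchange]

/-- The Dirichlet form of the exchange dynamics. -/
def exchangeForm (p : ℝ) (k : Config (ZMod n) → ℝ) : ℝ :=
  ∑ x : ZMod n, mean p (fun η => (k (exchange η x (x + 1)) - k η) ^ 2)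

/-- The gradient is odd and g is even under the exchange, which preserves the law. Symmetrizing
replaces k² by half its change, factored as a difference times a sum; Young's inequality with
parameter N separates the two. -/
lemma mean_gradient_mul_le (h0 : 0 < p) (h1 : p < 1) {N : ℝ} (hN : 0 < N) (y : ZMod n)
    {g k : Config (ZMod n) → ℝ} (hg : ∀ η, g (exchange η y (y + 1)) = g η) :
    mean p (fun η => (centered p η y - centered p η (y + 1)) * g η * k η ^ 2)
      ≤ N / 2 * mean p (fun η => (k (exchange η y (y + 1)) - k η) ^ 2)
        + 1 / (2 * N) * mean p (fun η => k η ^ 2 * g η ^ 2) := by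
  set e : Config (ZMod n) → Config (ZMod n) := fun η => exchange η y (y + 1) with he
  have hD : ∀ η, centered p (e η) y - centered p (e η) (y + 1)
      = -(centered p η y - centered p η (y + 1)) := by
    intro η; simp [centered, occ, exchange, he]
  have hD1 : ∀ η : Config (ZMod n), (centered p η y - centered p η (y + 1)) ^ 2 ≤ 1 := by
    intro η
    unfold centered
    rw [sub_sub_sub_cancel_right]
    rcases occ_mem η y with h | h <;> rcases occ_mem η (y + 1) with h' | h' <;> rw [h, h'] <;>
      norm_num
  have e1 := mean_exchange p y (y + 1)
    (fun η => (centered p η y - centered p η (y + 1)) * g η * k η ^ 2)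
  have e2 := mean_exchange p y (y + 1) (fun η => k η ^ 2 * g η ^ 2)
  have hpt : ∀ η, (centered p η y - centered p η (y + 1)) * g η * k η ^ 2
      + (centered p (e η) y - centered p (e η) (y + 1)) * g (e η) * k (e η) ^ 2
      ≤ N * (k (e η) - k η) ^ 2
        + 1 / (2 * N) * (k η ^ 2 * g η ^ 2 + k (e η) ^ 2 * g (e η) ^ 2) := by
    intro η
    rw [hD, hg]
    set D := centered p η y - centered p η (y + 1) with hDdef
    have hDle := hD1 η
    rw [← hDdef] at hDle
    set a := k η
    set b := k (e η)
    set G := g η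
    -- This square is Young's inequality for 4N·DG(a - b)(a + b); then D² ≤ 1 is used.
    have h2 : 0 ≤ (2 * N * (a - b) - D * G * (a + b)) ^ 2 := sq_nonneg _
    have h3 : D ^ 2 * (G ^ 2 * (a + b) ^ 2) ≤ 1 * (G ^ 2 * (a + b) ^ 2) :=
      mul_le_mul_of_nonneg_right hDle (by positivity)
    have h4 : G ^ 2 * (a + b) ^ 2 ≤ G ^ 2 * (2 * (a ^ 2 + b ^ 2)) :=
      mul_le_mul_of_nonneg_left (by nlinarith [sq_nonneg (a - b)]) (sq_nonneg _)
    have h5 : 4 * N * (D * G * (a ^ 2 - b ^ 2))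
        ≤ 4 * N * (N * (b - a) ^ 2 + 1 / (2 * N) * (a ^ 2 * G ^ 2 + b ^ 2 * G ^ 2)) := by
      have : 4 * N * (N * (b - a) ^ 2 + 1 / (2 * N) * (a ^ 2 * G ^ 2 + b ^ 2 * G ^ 2))
          = 4 * N ^ 2 * (a - b) ^ 2 + 2 * (G ^ 2 * (a ^ 2 + b ^ 2)) := by
        field_simp; ring
      rw [this]
      nlinarith
    have h6 := le_of_mul_le_mul_left h5 (by positivity)
    linarith
  have := mean_mono h0 h1 hpt
  rw [mean_add, mean_add, mean_const_mul, mean_const_mul, mean_add] at this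
  change mean p (fun η => (centered p (e η) y - centered p (e η) (y + 1)) * g (e η) * k (e η) ^ 2)
    = _ at e1
  change mean p (fun η => k (e η) ^ 2 * g (e η) ^ 2) = _ at e2
  rw [e1, e2] at this
  have h7 : 1 / (2 * N) * (mean p (fun η => k η ^ 2 * g η ^ 2)
      + mean p (fun η => k η ^ 2 * g η ^ 2))
      = 2 * (1 / (2 * N) * mean p (fun η => k η ^ 2 * g η ^ 2)) := by ring
  rw [h7] at this
  linarith

/-- A nonlocal field, invariant under the exchange of `y` and `y + 1`. -/
def innerField (lam p : ℝ) (η : Config (ZMod n)) (y : ZMod n) : ℝ :=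
  ∑ x, innerWeight (y - 1 - x) * pairing lam p η x

/-- `pairing` at x reads the sites x - 1 and x. These meet {y, y + 1} only for x = y, y + 1, y + 2,
exactly where `innerWeight` was set to 0. -/
lemma innerField_exchange (lam p : ℝ) (η : Config (ZMod n)) (y : ZMod n) :
    innerField lam p (exchange η y (y + 1)) y = innerField lam p η y := by
  unfold innerField
  refine Finset.sum_congr rfl fun x _ => ?_
  by_cases hz : y - 1 - x = -1 ∨ y - 1 - x = -2 ∨ y - 1 - x = -3
  · simp [innerWeight, hz]
  · push Not at hz
    obtain ⟨z1, z2, z3⟩ := hz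
    have n1 : x ≠ y := fun h => z1 (by rw [h]; ring)
    have n2 : x ≠ y + 1 := fun h => z2 (by rw [h]; ring)
    have n3 : x - 1 ≠ y := fun h => z2 (by rw [← h]; ring)
    have n4 : x - 1 ≠ y + 1 := fun h => z3 (by
      have : x = y + 2 := by linear_combination h
      rw [this]; ring)
    unfold pairing centered occ exchange
    simp only [Function.comp_apply, Equiv.swap_apply_of_ne_of_ne n1 n2,
      Equiv.swap_apply_of_ne_of_ne n3 n4]

/-- The centered variable at x + 1 is split into the spatial average and gradients. The average
meets the sum of the pairings in a product bounded by squares. Truncating the weights costs 3 ·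
(2/n) · B for each of the n gradients, in total 6B. -/
lemma potential_le (hlam : 0 < lam) (h0 : 0 < p) (h1 : p < 1) (η : Config (ZMod n)) :
    potential lam p η ≤
      ∑ y, (centered p η y - centered p η (y + 1)) * innerField lam p η y
      + 1 / (2 * n) * ((∑ x, centered p η x) ^ 2 + (∑ x, 1 * pairing lam p η x) ^ 2)
      + 6 * (2 * lam + lam / p) := by
  have hn : (0 : ℝ) < n := Nat.cast_pos.2 (NeZero.pos n)
  set B := 2 * lam + lam / p with hB
  have hB0 : 0 < B := by positivity
  set D : ZMod n → ℝ := fun y => centered p η y - centered p η (y + 1) with hD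
  have hD1 : ∀ y, |D y| ≤ 1 := by
    intro y
    simp only [hD, centered, sub_sub_sub_cancel_right]
    rcases occ_mem η y with h | h <;> rcases occ_mem η (y + 1) with h' | h' <;> rw [h, h'] <;>
      norm_num
  have hreindex : ∀ x, ∑ z, gradientWeight z * D (x + 1 + z)
      = ∑ y, gradientWeight (y - 1 - x) * D y := by
    intro x
    rw [← Equiv.sum_comp (Equiv.addLeft (x + 1)) (fun y => gradientWeight (y - 1 - x) * D y)]
    refine Finset.sum_congr rfl fun z _ => ?_
    simp only [Equiv.coe_addLeft]
    congr 2
    ring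
  have h2 : ∀ x, centered p η (x + 1) = (∑ y, centered p η y) / n
      + ∑ y, gradientWeight (y - 1 - x) * D y := by
    intro x
    rw [← hreindex, ← sub_eq_iff_eq_add']
    exact sub_average_eq_sum_gradient (fun y => centered p η y) (x + 1)
  have h3 : potential lam p η = (∑ x, pairing lam p η x) * ((∑ y, centered p η y) / n)
      + ∑ y, D y * innerField lam p η y
      + ∑ y, ∑ x, D y * ((gradientWeight (y - 1 - x) - innerWeight (y - 1 - x))
        * pairing lam p η x) := by
    unfold potential innerField
    simp only [h2, mul_add, Finset.sum_add_distrib, Finset.mul_sum]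
    rw [Finset.sum_mul, add_assoc]
    congr 1
    rw [Finset.sum_comm, ← Finset.sum_add_distrib]
    refine Finset.sum_congr rfl fun y _ => ?_
    rw [← Finset.sum_add_distrib]
    refine Finset.sum_congr rfl fun x _ => ?_
    ring
  have h4 : ∑ y, ∑ x, D y * ((gradientWeight (y - 1 - x) - innerWeight (y - 1 - x))
        * pairing lam p η x) ≤ 6 * B := by
    have hy : ∀ y, ∑ x, D y * ((gradientWeight (y - 1 - x) - innerWeight (y - 1 - x))
        * pairing lam p η x) ≤ 6 * B / n := by
      intro y
      have hx : ∀ x, D y * ((gradientWeight (y - 1 - x) - innerWeight (y - 1 - x))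
          * pairing lam p η x) ≤ B * (2 / n * ((if y - 1 - x = -1 then 1 else 0)
          + (if y - 1 - x = -2 then 1 else 0) + (if y - 1 - x = -3 then 1 else 0))) := by
        intro x
        refine (le_abs_self _).trans ?_
        rw [abs_mul, abs_mul]
        have a1 := abs_gradientWeight_sub_innerWeight_le (y - 1 - x)
        have a2 := abs_pairing_le hlam h0 h1 η x
        have a3 := mul_le_mul a1 a2 (abs_nonneg _) ((abs_nonneg _).trans a1)
        have a4 := mul_le_mul (hD1 y) a3 (by positivity) zero_le_one
        rw [one_mul] at a4
        exact a4.trans_eq (mul_comm _ _)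
      refine (Finset.sum_le_sum fun x _ => hx x).trans ?_
      have hs := Equiv.sum_comp (Equiv.subLeft (y - 1)) (fun z : ZMod n =>
        ((if z = -1 then (1 : ℝ) else 0) + (if z = -2 then 1 else 0) + (if z = -3 then 1 else 0)))
      simp only [Equiv.subLeft_apply] at hs
      rw [← Finset.mul_sum, ← Finset.mul_sum, hs,
        Finset.sum_add_distrib, Finset.sum_add_distrib]
      simp only [Finset.sum_ite_eq', Finset.mem_univ, if_true]
      apply le_of_eq
      ring
    refine (Finset.sum_le_sum fun y _ => hy y).trans (le_of_eq ?_)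
    rw [Finset.sum_const, Finset.card_univ, ZMod.card, nsmul_eq_mul]
    field_simp
  have h5 : (∑ x, pairing lam p η x) * ((∑ y, centered p η y) / n)
      ≤ 1 / (2 * n) * ((∑ x, centered p η x) ^ 2 + (∑ x, 1 * pairing lam p η x) ^ 2) := by
    simp only [one_mul]
    set s := ∑ x, pairing lam p η x
    set t := ∑ x, centered p η x
    have : s * (t / n) = 1 / (2 * n) * (2 * s * t) := by field_simp
    rw [this]
    exact mul_le_mul_of_nonneg_left (by nlinarith [sq_nonneg (s - t)]) (by positivity)
  rw [h3]
  linarith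

/-- The potential is controlled by the Dirichlet form of the accelerated exchange dynamics and by
the entropy, uniformly in the size of the torus. -/
theorem mean_potential_mul_le (hlam : 0 < lam) (h0 : 0 < p) (h1 : p < 1) :
    ∃ K C : ℝ, 0 < K ∧ 0 < C ∧ ∀ (n : ℕ) [NeZero n], 3 ≤ n → ∀ k : Config (ZMod n) → ℝ,
      (∀ η, 0 < k η) →
      mean p (fun η => potential lam p η * k η ^ 2)
        ≤ (n : ℝ) ^ 2 / 2 * exchangeForm p k + K * entropy p (fun η => k η ^ 2)
          + C * mean p (fun η => k η ^ 2) := by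
  set B := 2 * lam + lam / p with hB
  have hB0 : 0 < B := by positivity
  -- A common bound for the difference constants 6 and 6B of the two kinds of sums.
  set c := 6 * (B + 1) with hc
  have hc0 : 0 < c := by positivity
  refine ⟨6 * c ^ 2, 6 * c ^ 2 * Real.log 2 + 6 * B, by positivity, ?_, ?_⟩
  · have := Real.log_pos (by norm_num : (1 : ℝ) < 2)
    positivity
  intro n _ hn k hk
  have hn0 : (0 : ℝ) < n := by positivity
  set E := entropy p (fun η => k η ^ 2) + mean p (fun η => k η ^ 2) * Real.log 2 with hE
  have hk2 : ∀ η, 0 < k η ^ 2 := fun η => pow_pos (hk η) 2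
  have hsq : ∀ (c' : ℝ) (S : Config (ZMod n) → ℝ), 0 ≤ c' → c' ≤ c → BoundedDifferences c' S →
      mean p S = 0 → mean p (fun η => k η ^ 2 * S η ^ 2) ≤ 4 * c ^ 2 * n * E := by
    intro c' S hc' hcc hS hm
    have := mean_mul_sq_le_entropy (κ := 1 / (4 * c ^ 2 * n)) h0 h1 hk2 hS hm (by positivity) (by
      rw [ZMod.card]
      have : 4 * (1 / (4 * c ^ 2 * n)) * c' ^ 2 * n = (c' / c) ^ 2 := by field_simp
      rw [this]
      have h2 : c' / c ≤ 1 := (div_le_one hc0).2 hcc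
      exact pow_le_one₀ (by positivity) h2)
    rw [one_div, inv_mul_le_iff₀ (by positivity)] at this
    exact this
  have b1 := hsq _ _ (by norm_num) (by rw [hc]; linarith)
    (boundedDifferences_sum_centered (n := n) h0 h1) (mean_sum_centered hn p)
  have b2 : ∀ a : ZMod n → ℝ, (∀ x, |a x| ≤ 1) →
      mean p (fun η => k η ^ 2 * (∑ x, a x * pairing lam p η x) ^ 2) ≤ 4 * c ^ 2 * n * E :=
    fun a ha => hsq _ _ (by positivity) (by rw [hc]; linarith)
      (boundedDifferences_sum_mul_pairing hlam h0 h1 ha) (mean_sum_mul_pairing hn lam p a)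
  have b3 := b2 (fun _ => 1) (by simp)
  have hpot : mean p (fun η => potential lam p η * k η ^ 2)
      ≤ mean p (fun η => ∑ y, (centered p η y - centered p η (y + 1)) * innerField lam p η y
          * k η ^ 2
        + (1 / (2 * n) * (k η ^ 2 * (∑ x, centered p η x) ^ 2
          + k η ^ 2 * (∑ x, 1 * pairing lam p η x) ^ 2)
        + 6 * B * k η ^ 2)) := by
    refine mean_mono h0 h1 fun η => ?_
    refine (mul_le_mul_of_nonneg_right (potential_le hlam h0 h1 η) (hk2 η).le).trans
      (le_of_eq ?_)
    rw [← Finset.sum_mul]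
    ring
  rw [mean_add, mean_add, mean_const_mul, mean_const_mul, mean_add, mean_sum] at hpot
  -- With N = n², each of the n gradients costs (1/(2n²)) · 4c²nE = 2c²E/n. Together with the 4c²E
  -- of the average part this gives K = 6c².
  have hgrad : ∑ y, mean p (fun η => (centered p η y - centered p η (y + 1))
        * innerField lam p η y * k η ^ 2)
      ≤ (n : ℝ) ^ 2 / 2 * exchangeForm p k + 2 * c ^ 2 * E := by
    have hy : ∀ y : ZMod n, mean p (fun η => (centered p η y - centered p η (y + 1))
        * innerField lam p η y * k η ^ 2)
        ≤ (n : ℝ) ^ 2 / 2 * mean p (fun η => (k (exchange η y (y + 1)) - k η) ^ 2)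
          + 2 * c ^ 2 * E / n := by
      intro y
      refine (mean_gradient_mul_le h0 h1 (by positivity : (0 : ℝ) < (n : ℝ) ^ 2) y
        (fun η => innerField_exchange lam p η y)).trans (add_le_add le_rfl ?_)
      have := b2 (fun x => innerWeight (y - 1 - x)) fun x => abs_innerWeight_le _
      refine (mul_le_mul_of_nonneg_left this (by positivity)).trans (le_of_eq ?_)
      field_simp
      ring
    refine (Finset.sum_le_sum fun y _ => hy y).trans (le_of_eq ?_)
    rw [Finset.sum_add_distrib, ← Finset.mul_sum, Finset.sum_const, Finset.card_univ, ZMod.card,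
      nsmul_eq_mul, mul_div_cancel₀ _ hn0.ne']
    rfl
  have hquad : 1 / (2 * (n : ℝ)) * (mean p (fun η => k η ^ 2 * (∑ x, centered p η x) ^ 2)
      + mean p (fun η => k η ^ 2 * (∑ x, 1 * pairing lam p η x) ^ 2)) ≤ 4 * c ^ 2 * E := by
    refine (mul_le_mul_of_nonneg_left (add_le_add b1 b3) (by positivity)).trans (le_of_eq ?_)
    field_simp
    ring
  have : 6 * c ^ 2 * E = 6 * c ^ 2 * entropy p (fun η => k η ^ 2)
      + 6 * c ^ 2 * Real.log 2 * mean p (fun η => k η ^ 2) := by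
    rw [hE]; ring
  linarith

end Potential

/-! ### Hypercontractive bound for the semigroup -/

section Hypercontractivity

set_option linter.unusedSectionVars false

/-- With r = q/2 the right side is 2a^r(b^r - a^r), so the claim is Bernoulli's inequality for
(b/a)^r. -/
lemma rpow_carre_du_champ_le {a b q : ℝ} (ha : 0 < a) (hb : 0 < b) (hq : 2 ≤ q) :
    q * a ^ (q - 1) * (b - a) ≤ (b ^ q - a ^ q) - (b ^ (q / 2) - a ^ (q / 2)) ^ 2 := by
  set r := q / 2 with hr
  have hqr : q = r + r := by rw [hr]; ring
  have hr1 : 1 ≤ r := by rw [hr]; linarith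
  have h1 := one_add_mul_self_le_rpow_one_add (s := b / a - 1)
    (by have : 0 < b / a := by positivity
        linarith) hr1
  rw [add_sub_cancel, Real.div_rpow hb.le ha.le, le_div_iff₀ (by positivity)] at h1
  have h2 : a ^ (q - 1) = a ^ r * (a ^ r / a) := by
    rw [← Real.rpow_sub_one ha.ne', ← Real.rpow_add ha]
    congr 1
    rw [hqr]; ring
  have h3 : ∀ c : ℝ, 0 < c → c ^ q = (c ^ r) ^ 2 := by
    intro c hc
    rw [hqr, Real.rpow_add hc, sq]
  rw [h2, h3 a ha, h3 b hb]
  have hA : 0 < a ^ r := by positivity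
  have h4 : q * (a ^ r * (a ^ r / a)) * (b - a) = 2 * a ^ r * (r * (b / a - 1) * a ^ r) := by
    rw [hqr]; field_simp; ring
  rw [h4]
  nlinarith

variable {n : ℕ} [NeZero n] {p lam : ℝ}

lemma flipRate_nonneg (hlam : 0 < lam) (η : Config (ZMod n)) (x : ZMod n) :
    0 ≤ flipRate lam η x := by
  unfold flipRate birthRate deathRate
  rcases occ_mem η x with h | h <;> rcases occ_mem η (x - 1) with h' | h' <;>
    rcases occ_mem η (x + 1) with h'' | h'' <;> rw [h, h', h''] <;> norm_num
  linarith

/-- The exchanges preserve the law, so only their Dirichlet form survives. For the reaction the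
square is discarded and duality brings in the potential. -/
lemma mean_rpow_mul_generator_le (hn : 3 ≤ n) (hlam : 0 < lam) (h0 : 0 < p) (h1 : p < 1)
    (hF : (1 - p) * (1 + lam * p ^ 2) - p = 0) {u : Config (ZMod n) → ℝ} (hu : ∀ η, 0 < u η)
    {q : ℝ} (hq : 2 ≤ q) :
    mean p (fun η => q * u η ^ (q - 1) * generator n lam u η)
      ≤ mean p (fun η => potential lam p η * u η ^ q)
        - (n : ℝ) ^ 2 * exchangeForm p (fun η => u η ^ (q / 2)) := by
  rw [← mean_reaction hn h0 h1 hF (fun η => u η ^ q)]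
  have hpt : ∀ η, q * u η ^ (q - 1) * generator n lam u η
      ≤ (n : ℝ) ^ 2 * (∑ x, (u (exchange η x (x + 1)) ^ q - u η ^ q))
        - (n : ℝ) ^ 2 * (∑ x, (u (exchange η x (x + 1)) ^ (q / 2) - u η ^ (q / 2)) ^ 2)
        + ∑ x, flipRate lam η x * (u (flip η x) ^ q - u η ^ q) := by
    intro η
    have e1 : q * u η ^ (q - 1) * ∑ x, (u (exchange η x (x + 1)) - u η)
        ≤ ∑ x, (u (exchange η x (x + 1)) ^ q - u η ^ q)
          - ∑ x, (u (exchange η x (x + 1)) ^ (q / 2) - u η ^ (q / 2)) ^ 2 := by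
      rw [Finset.mul_sum, ← Finset.sum_sub_distrib]
      exact Finset.sum_le_sum fun x _ => rpow_carre_du_champ_le (hu _) (hu _) hq
    have e2 : q * u η ^ (q - 1) * ∑ x, flipRate lam η x * (u (flip η x) - u η)
        ≤ ∑ x, flipRate lam η x * (u (flip η x) ^ q - u η ^ q) := by
      rw [Finset.mul_sum]
      refine Finset.sum_le_sum fun x _ => ?_
      have e3 := rpow_carre_du_champ_le (hu η) (hu (flip η x)) hq
      have e4 := mul_le_mul_of_nonneg_left
        (e3.trans (sub_le_self _ (sq_nonneg _))) (flipRate_nonneg hlam η x)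
      refine le_trans (le_of_eq ?_) e4
      ring
    have e5 := mul_le_mul_of_nonneg_left e1 (sq_nonneg (n : ℝ))
    change q * u η ^ (q - 1) * ((n : ℝ) ^ 2 * (∑ x : ZMod n, (u (exchange η x (x + 1)) - u η)) +
      ∑ x : ZMod n, flipRate lam η x * (u (flip η x) - u η)) ≤ _
    rw [mul_add]
    refine add_le_add (le_trans (le_of_eq ?_) (e5.trans_eq (mul_sub _ _ _))) e2
    ring
  refine (mean_mono h0 h1 hpt).trans (le_of_eq ?_)
  rw [mean_add, mean_sub, mean_const_mul, mean_const_mul, mean_sum, mean_sum]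
  have e6 : ∑ x : ZMod n, mean p (fun η => u (exchange η x (x + 1)) ^ q - u η ^ q) = 0 := by
    refine Finset.sum_eq_zero fun x _ => ?_
    rw [mean_sub, mean_exchange p x (x + 1) (fun η => u η ^ q), sub_self]
  rw [e6]
  unfold exchangeForm
  ring

lemma hasDerivAt_semigroup {E : Type*} [Fintype E] (L : (E → ℝ) →ₗ[ℝ] (E → ℝ)) (g : E → ℝ)
    (t : ℝ) (x : E) :
    HasDerivAt (fun t => semigroup L t g x) (L (semigroup L t g) x) t := by
  have h := hasDerivAt_exp_smul_const' (𝕂 := ℝ) (LinearMap.toContinuousLinearMap L) t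
  have h2 := h.clm_apply (hasDerivAt_const t g)
  have h3 := hasDerivAt_pi.1 h2 x
  simpa [semigroup] using h3

lemma semigroup_zero {E : Type*} [Fintype E] (L : (E → ℝ) →ₗ[ℝ] (E → ℝ)) (g : E → ℝ) :
    semigroup L 0 g = g := by
  simp [semigroup]

/-- The semigroup maps `L^Q` to `L¹` of the Bernoulli product law, uniformly in the size of the
torus and in bounded time. -/
theorem mean_semigroup_le (hlam : 0 < lam) (h0 : 0 < p) (h1 : p < 1)
    (hF : (1 - p) * (1 + lam * p ^ 2) - p = 0) {T : ℝ} (hT : 0 < T) :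
    ∃ Q C : ℝ, 2 ≤ Q ∧ 0 < C ∧ ∀ (n : ℕ) [NeZero n], 3 ≤ n → ∀ g : Config (ZMod n) → ℝ,
      (∀ t, 0 ≤ t → ∀ η, 0 < semigroup (generator n lam) t g η) → ∀ t ∈ Set.Icc (0 : ℝ) T,
      mean p (semigroup (generator n lam) t g) ≤ C * mean p (fun η => g η ^ Q) ^ (1 / Q) := by
  obtain ⟨K, C, hK, hC, hpot⟩ := mean_potential_mul_le hlam h0 h1
  -- The initial exponent is chosen so that q(s) = Q exp(-Ks) is still at least 2 at time T.
  set Q := 2 * Real.exp (K * T) with hQ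
  have hQ2 : 2 ≤ Q := by
    have := Real.one_le_exp (by positivity : 0 ≤ K * T)
    linarith
  refine ⟨Q, Real.exp (C * T), hQ2, Real.exp_pos _, ?_⟩
  intro n _ hn g hsemi t ht
  set u : ℝ → Config (ZMod n) → ℝ := fun t => semigroup (generator n lam) t g with hu
  have hpos : ∀ s, 0 ≤ s → ∀ η, 0 < u s η := hsemi
  set q : ℝ → ℝ := fun t => Q * Real.exp (-(K * t)) with hq
  have hq2 : ∀ s, s ≤ T → 2 ≤ q s := by
    intro s hs
    have : q s = 2 * Real.exp (K * (T - s)) := by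
      simp only [hq, hQ]
      rw [mul_assoc, ← Real.exp_add]
      ring_nf
    rw [this]
    have := Real.one_le_exp (mul_nonneg hK.le (sub_nonneg.2 hs))
    linarith
  have hqd : ∀ s, HasDerivAt q (-K * q s) s := by
    intro s
    have := ((((hasDerivAt_id s).const_mul K).neg).exp).const_mul Q
    refine this.congr_deriv ?_
    simp [hq]
    ring
  set Φ : ℝ → ℝ := fun s => mean p (fun η => u s η ^ q s) with hΦ
  have hΦpos : ∀ s, 0 ≤ s → 0 < Φ s := fun s hs =>
    mean_pos h0 h1 fun η => Real.rpow_pos_of_pos (hpos s hs η) _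
  have hΦd : ∀ s, 0 ≤ s → HasDerivAt Φ
      (mean p (fun η => q s * u s η ^ (q s - 1) * generator n lam (u s) η)
        - K * mean p (fun η => u s η ^ q s * Real.log (u s η ^ q s))) s := by
    intro s hs
    have hη : ∀ η ∈ Finset.univ, HasDerivAt (fun s => weight p η * u s η ^ q s)
        (weight p η * (generator n lam (u s) η * q s * u s η ^ (q s - 1)
          + (-K * q s) * u s η ^ q s * Real.log (u s η))) s := fun η _ =>
      ((hasDerivAt_semigroup (generator n lam) g s η).rpow (hqd s) (hpos s hs η)).const_mul _
    refine (HasDerivAt.fun_sum hη).congr_deriv ?_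
    rw [← mean_const_mul, ← mean_sub]
    refine Finset.sum_congr rfl fun η _ => ?_
    have := Real.log_rpow (hpos s hs η) (q s)
    simp only [this]
    ring
  set φ : ℝ → ℝ := fun s => Real.log (Φ s) / q s with hφ
  have hφd : ∀ s, 0 ≤ s → s ≤ T → ∃ d, HasDerivAt φ d s ∧ d ≤ C := by
    intro s hs hsT
    have hqs := hq2 s hsT
    have hq0 : 0 < q s := by linarith
    refine ⟨_, ((hΦd s hs).log (hΦpos s hs).ne').div (hqd s) hq0.ne', ?_⟩
    have hkpos : ∀ η, 0 < u s η ^ (q s / 2) := fun η => Real.rpow_pos_of_pos (hpos s hs η) _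
    have hk2 : ∀ η, (u s η ^ (q s / 2)) ^ 2 = u s η ^ q s := by
      intro η
      rw [← Real.rpow_natCast, ← Real.rpow_mul (hpos s hs η).le]
      norm_num
    have e1 := mean_rpow_mul_generator_le hn hlam h0 h1 hF (hpos s hs) hqs
    have e2 := hpot n hn (fun η => u s η ^ (q s / 2)) hkpos
    simp only [hk2] at e2
    have e3 : 0 ≤ (n : ℝ) ^ 2 * exchangeForm p (fun η => u s η ^ (q s / 2)) := by
      refine mul_nonneg (sq_nonneg _) (Finset.sum_nonneg fun x _ => ?_)
      exact Finset.sum_nonneg fun η _ => mul_nonneg (weight_pos h0 h1 η).le (sq_nonneg _)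
    unfold entropy at e2
    set M := mean p (fun η => q s * u s η ^ (q s - 1) * generator n lam (u s) η)
    set N := mean p (fun η => u s η ^ q s * Real.log (u s η ^ q s))
    change M ≤ _ at e1
    -- N is the part of the entropy produced by q' = -Kq, and it cancels here. The remaining -K log
    -- Φ cancels against the derivative of 1/q in φ = log Φ / q, so φ' ≤ C/q ≤ C.
    have e4 : M - K * N ≤ (C - K * Real.log (Φ s)) * Φ s := by
      simp only [hΦ]
      linarith
    have e5 : (M - K * N) / Φ s ≤ C - K * Real.log (Φ s) := (div_le_iff₀ (hΦpos s hs)).2 e4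
    rw [div_le_iff₀ (by positivity)]
    have e6 := mul_le_mul_of_nonneg_right e5 hq0.le
    nlinarith [mul_nonneg hC.le hq0.le, mul_le_mul_of_nonneg_left hqs (mul_nonneg hC.le hq0.le)]
  have hmono : φ t ≤ φ 0 + C * t := by
    have hcont : ContinuousOn φ (Set.Icc 0 T) := fun s hs => by
      obtain ⟨d, hd, _⟩ := hφd s hs.1 hs.2
      exact hd.continuousAt.continuousWithinAt
    have hint : ∀ s ∈ interior (Set.Icc 0 T), s ∈ Set.Icc 0 T := fun s hs => interior_subset hs
    have := Convex.image_sub_le_mul_sub_of_deriv_le (convex_Icc 0 T) hcont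
      (fun s hs => by
        obtain ⟨d, hd, _⟩ := hφd s (hint s hs).1 (hint s hs).2
        exact hd.differentiableAt.differentiableWithinAt)
      (C := C) (fun s hs => by
        obtain ⟨d, hd, hdC⟩ := hφd s (hint s hs).1 (hint s hs).2
        rw [hd.deriv]; exact hdC)
      0 ⟨le_rfl, hT.le⟩ t ht ht.1
    linarith
  have hexp : ∀ s, 0 ≤ s → Real.exp (φ s) = Φ s ^ (1 / q s) := by
    intro s hs
    rw [Real.rpow_def_of_pos (hΦpos s hs), mul_one_div]
  have hq0 : q 0 = Q := by simp [hq]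
  have hΦ0 : Φ 0 = mean p (fun η => g η ^ Q) := by
    simp only [hΦ, hq0, hu, semigroup_zero]
  have hJ : mean p (u t) ≤ Φ t ^ (1 / q t) :=
    Real.arith_mean_le_rpow_mean Finset.univ (fun η => weight p η) (u t)
      (fun η _ => (weight_pos h0 h1 η).le) (sum_weight p) (fun η _ => (hpos t ht.1 η).le)
      (by linarith [hq2 t ht.2])
  refine hJ.trans ?_
  rw [← hexp t ht.1, ← hΦ0, ← hq0, ← hexp 0 le_rfl, ← Real.exp_add]
  refine Real.exp_le_exp.2 ?_
  nlinarith [mul_le_mul_of_nonneg_left ht.2 hC.le]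

end Hypercontractivity

/-! ### The generator applied to the fluctuation field -/

section Fluctuation

/-- The net rate of births at `x`. -/
def netRate {n : ℕ} (lam : ℝ) (η : Config (ZMod n)) (x : ZMod n) : ℝ :=
  (1 - occ η x) * (1 + lam * (occ η (x - 1) * occ η (x + 1))) - occ η x

/-- The discrete Laplacian on the torus, with mesh `1 / n`. -/
def discreteLaplacian {n : ℕ} (F : ZMod n → ℝ) (x : ZMod n) : ℝ :=
  (n : ℝ) ^ 2 * (F (x + 1) + F (x - 1) - 2 * F x)

variable {n : ℕ} [NeZero n]

lemma sum_swap_sub (F O : ZMod n → ℝ) (a b : ZMod n) :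
    ∑ y, F y * (O (Equiv.swap a b y) - O y) = (F b - F a) * (O a - O b) := by
  have h : ∀ y, F y * (O (Equiv.swap a b y) - O y)
      = (if y = a then F a * (O b - O a) else 0) + (if y = b then F b * (O a - O b) else 0) := by
    intro y
    by_cases h1 : y = a
    · subst h1
      by_cases h2 : y = b
      · subst h2; simp
      · simp [h2]
    · by_cases h2 : y = b
      · subst h2; simp [h1]
      · simp [h1, h2, Equiv.swap_apply_of_ne_of_ne h1 h2]
  simp only [h, Finset.sum_add_distrib, Finset.sum_ite_eq', Finset.mem_univ, if_true]
  ring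

/-- Two summations by parts turn the exchange part into a discrete Laplacian of f. Centering η there
is free, since a discrete Laplacian sums to 0 over the torus. -/
lemma generator_fluctuation (lam : ℝ) (ρ : I) (f : UnitAddCircle → ℝ) (η : Config (ZMod n)) :
    generator n lam (fluctuation n ρ f) η = (Real.sqrt n)⁻¹ *
      ∑ x, (discreteLaplacian (fun y : ZMod n => f (ZMod.toAddCircle y)) x * centered (ρ : ℝ) η x
        + f (ZMod.toAddCircle x) * netRate lam η x) := by
  set F : ZMod n → ℝ := fun y => f (ZMod.toAddCircle y) with hF
  have hfl : ∀ ζ : Config (ZMod n), fluctuation n ρ f ζ - fluctuation n ρ f η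
      = (Real.sqrt n)⁻¹ * ∑ y, F y * (occ ζ y - occ η y) := by
    intro ζ
    unfold fluctuation
    rw [← mul_sub, ← Finset.sum_sub_distrib]
    congr 1
    exact Finset.sum_congr rfl fun y _ => by simp only [hF]; ring
  have hex : ∀ x, fluctuation n ρ f (exchange η x (x + 1)) - fluctuation n ρ f η
      = (Real.sqrt n)⁻¹ * ((F (x + 1) - F x) * (occ η x - occ η (x + 1))) := by
    intro x
    rw [hfl, ← sum_swap_sub F (fun y => occ η y) x (x + 1)]
    rfl
  have hflip : ∀ x, flipRate lam η x * (fluctuation n ρ f (flip η x) - fluctuation n ρ f η)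
      = (Real.sqrt n)⁻¹ * (F x * netRate lam η x) := by
    intro x
    have h1 : ∑ y, F y * (occ (flip η x) y - occ η y) = F x * (1 - 2 * occ η x) := by
      rw [Finset.sum_eq_single x]
      · have : occ (flip η x) x = 1 - occ η x := by
          unfold occ flip; rw [Function.update_self]; cases η x <;> simp
        rw [this]; ring
      · intro y _ hy
        simp [occ, flip, Function.update_of_ne hy]
      · simp
    rw [hfl, h1]
    unfold flipRate birthRate deathRate netRate
    rcases occ_mem η x with h | h <;> rw [h] <;> ring
  change (n : ℝ) ^ 2 * (∑ x : ZMod n, (fluctuation n ρ f (exchange η x (x + 1))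
      - fluctuation n ρ f η)) +
    ∑ x : ZMod n, flipRate lam η x * (fluctuation n ρ f (flip η x) - fluctuation n ρ f η) = _
  simp only [hex, hflip]
  rw [← Finset.mul_sum, ← Finset.mul_sum, Finset.sum_add_distrib, mul_add]
  congr 1
  rw [mul_left_comm]
  congr 1
  have s1 : ∑ x, F (x + 1) * occ η (x + 1) = ∑ x, F x * occ η x :=
    Equiv.sum_comp (Equiv.addRight (1 : ZMod n)) (fun x => F x * occ η x)
  have s2 : ∑ x, F (x - 1) * occ η x = ∑ x, F x * occ η (x + 1) := by
    rw [← Equiv.sum_comp (Equiv.addRight (1 : ZMod n)) (fun x => F (x - 1) * occ η x)]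
    simp
  have s3 : ∑ x, F (x + 1) = ∑ x, F x := Equiv.sum_comp (Equiv.addRight (1 : ZMod n)) F
  have s4 : ∑ x, F (x - 1) = ∑ x, F x := Equiv.sum_comp (Equiv.subRight (1 : ZMod n)) F
  have s5 : ∑ x, (F (x + 1) - F x) * (occ η x - occ η (x + 1))
      = ∑ x, F (x + 1) * occ η x - ∑ x, F x * occ η x - ∑ x, F (x + 1) * occ η (x + 1)
        + ∑ x, F x * occ η (x + 1) := by
    rw [← Finset.sum_sub_distrib, ← Finset.sum_sub_distrib, ← Finset.sum_add_distrib]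
    exact Finset.sum_congr rfl fun x _ => by ring
  have s6 : ∑ x, discreteLaplacian F x * centered (ρ : ℝ) η x
      = (n : ℝ) ^ 2 * ((∑ x, F (x + 1) * occ η x + ∑ x, F (x - 1) * occ η x
          - 2 * ∑ x, F x * occ η x)
        - ρ * (∑ x, F (x + 1) + ∑ x, F (x - 1) - 2 * ∑ x, F x)) := by
    simp only [Finset.mul_sum, ← Finset.sum_add_distrib, ← Finset.sum_sub_distrib]
    refine Finset.sum_congr rfl fun x _ => ?_
    unfold discreteLaplacian centered
    ring
  rw [s5, s6, s1, s2, s3, s4]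
  ring

lemma exists_forall_abs_le_of_periodic {F : ℝ → ℝ} (hF : Function.Periodic F 1)
    (hc : Continuous F) : ∃ M, 0 < M ∧ ∀ u, |F u| ≤ M := by
  obtain ⟨M, hM⟩ := (hF.compact_of_continuous one_ne_zero hc).isBounded.exists_norm_le
  refine ⟨max M 1, by positivity, fun u => ?_⟩
  exact (hM (F u) ⟨u, rfl⟩).trans (le_max_left _ _)

lemma periodic_deriv {F : ℝ → ℝ} (hF : Function.Periodic F 1) :
    Function.Periodic (deriv F) 1 := fun u => by
  rw [← deriv_comp_add_const]
  congr 1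
  funext v
  exact hF v

/-- The function s ↦ F(u + s) + F(u - s) has derivative at most 2Mh on [0, h], because F' is
M-Lipschitz. -/
lemma abs_second_difference_le {F : ℝ → ℝ} (hp : Function.Periodic F 1)
    (hF : ContDiff ℝ ((⊤ : ℕ∞) : WithTop ℕ∞) F) :
    ∃ M, 0 < M ∧ ∀ u h, 0 ≤ h → |F (u + h) + F (u - h) - 2 * F u| ≤ M * h ^ 2 := by
  have hF1 : ContDiff ℝ 1 (deriv F) := by
    have : ContDiff ℝ (1 + 1) F := by
      rw [one_add_one_eq_two]
      exact_mod_cast contDiff_infty.1 hF 2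
    exact (contDiff_succ_iff_deriv.1 this).2.2
  have hd : Differentiable ℝ F := hF.differentiable (by simp)
  have hd1 : Differentiable ℝ (deriv F) := hF1.differentiable (by norm_num)
  obtain ⟨M, hM, hbd⟩ := exists_forall_abs_le_of_periodic (periodic_deriv (periodic_deriv hp))
    (hF1.continuous_deriv le_rfl)
  have hlip : ∀ a b, |deriv F b - deriv F a| ≤ M * |b - a| := fun a b =>
    Convex.norm_image_sub_le_of_norm_deriv_le (fun x _ => hd1 x) (fun x _ => hbd x) convex_univ
      (Set.mem_univ a) (Set.mem_univ b)
  refine ⟨2 * M, by positivity, fun u h hh => ?_⟩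
  have hder : ∀ s, HasDerivAt (fun s => F (u + s) + F (u - s))
      (deriv F (u + s) - deriv F (u - s)) s := by
    intro s
    have e1 := (hd (u + s)).hasDerivAt.comp_const_add u s
    have e2 := (hd (u - s)).hasDerivAt.comp_const_sub u s
    exact (e1.add e2).congr_deriv (by ring)
  have := Convex.norm_image_sub_le_of_norm_hasDerivWithin_le (C := 2 * M * h)
    (fun s _ => (hder s).hasDerivWithinAt) (fun s (hs : s ∈ Set.Icc 0 h) => by
      refine (hlip _ _).trans ?_
      rw [show u + s - (u - s) = 2 * s by ring, abs_of_nonneg (by linarith [hs.1])]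
      nlinarith [hs.2]) (convex_Icc 0 h) ⟨le_rfl, hh⟩ ⟨hh, le_rfl⟩
  simp only [add_zero, sub_zero, Real.norm_eq_abs, abs_of_nonneg hh] at this
  rw [show F (u + h) + F (u - h) - 2 * F u = F (u + h) + F (u - h) - (F u + F u) by ring]
  refine this.trans (le_of_eq ?_)
  ring

lemma abs_discreteLaplacian_le {f : UnitAddCircle → ℝ}
    (hf : ContDiff ℝ ((⊤ : ℕ∞) : WithTop ℕ∞) (fun u : ℝ => f (u : UnitAddCircle))) :
    ∃ M, 0 < M ∧ (∀ z, |f z| ≤ M) ∧ ∀ (n : ℕ) [NeZero n] (x : ZMod n),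
      |discreteLaplacian (fun y : ZMod n => f (ZMod.toAddCircle y)) x| ≤ M := by
  have hp : Function.Periodic (fun u : ℝ => f (u : UnitAddCircle)) 1 := fun u => by
    simp
  obtain ⟨M₁, hM₁, hb₁⟩ := abs_second_difference_le hp hf
  obtain ⟨M₂, hM₂, hb₂⟩ := exists_forall_abs_le_of_periodic hp hf.continuous
  refine ⟨max M₁ M₂, by positivity, fun z => ?_, fun n _ x => ?_⟩
  · obtain ⟨u, rfl⟩ := QuotientAddGroup.mk_surjective z
    exact (hb₂ u).trans (le_max_right _ _)
  · have hn : (0 : ℝ) < n := Nat.cast_pos.2 (NeZero.pos n)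
    obtain ⟨u, hu⟩ := QuotientAddGroup.mk_surjective (ZMod.toAddCircle x)
    have h1 : ZMod.toAddCircle (1 : ZMod n) = ((1 / n : ℝ) : UnitAddCircle) := by
      have := ZMod.toAddCircle_intCast (N := n) 1
      simpa using this
    have hb := hb₁ u (1 / n) (by positivity)
    have e1 : ((u + 1 / n : ℝ) : UnitAddCircle) = ZMod.toAddCircle (x + 1) := by
      rw [map_add, h1, ← hu]; rfl
    have e2 : ((u - 1 / n : ℝ) : UnitAddCircle) = ZMod.toAddCircle (x - 1) := by
      rw [map_sub, h1, ← hu]; rfl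
    have e3 : ((u : ℝ) : UnitAddCircle) = ZMod.toAddCircle x := hu
    simp only [e1, e2, e3] at hb
    unfold discreteLaplacian
    rw [abs_mul, abs_of_nonneg (sq_nonneg _)]
    refine (mul_le_mul_of_nonneg_left hb (sq_nonneg _)).trans (le_trans (le_of_eq ?_)
      (le_max_left _ _))
    field_simp

/-- The rescaled drift of the fluctuation field is of order one, with sub-Gaussian tails under the
Bernoulli product law. -/
lemma generator_fluctuation_bounds {lam : ℝ} (hlam : 0 < lam) {ρ : I} (h0 : (0 : ℝ) < ρ)
    (h1 : (ρ : ℝ) < 1) (hF : (1 - (ρ : ℝ)) * (1 + lam * (ρ : ℝ) ^ 2) - ρ = 0)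
    {f : UnitAddCircle → ℝ}
    (hf : ContDiff ℝ ((⊤ : ℕ∞) : WithTop ℕ∞) (fun u : ℝ => f (u : UnitAddCircle))) :
    ∃ A : ℝ, 0 < A ∧ ∀ (n : ℕ) [NeZero n],
      (∀ η, |generator n lam (fluctuation n ρ f) η| ≤ A * Real.sqrt n) ∧
      (3 ≤ n → ∀ s : ℝ, mean (ρ : ℝ) (fun η => Real.exp (s * generator n lam (fluctuation n ρ f) η))
        ≤ Real.exp (s ^ 2 * (6 * A) ^ 2 / 2)) := by
  obtain ⟨M, hM, hbf, hbl⟩ := abs_discreteLaplacian_le hf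
  refine ⟨M + M * (2 + lam), by positivity, fun n _ => ?_⟩
  have hn : (0 : ℝ) < n := Nat.cast_pos.2 (NeZero.pos n)
  have hs : 0 < Real.sqrt n := Real.sqrt_pos.2 hn
  set F : ZMod n → ℝ := fun y : ZMod n => f (ZMod.toAddCircle y) with hFdef
  set o : Bool → ℝ := fun b => if b then 1 else 0 with ho
  set H : ZMod n → Bool → Bool → Bool → ℝ := fun x a b c =>
    discreteLaplacian F x * (o b - ρ) + F x * ((1 - o b) * (1 + lam * (o a * o c)) - o b) with hH
  have hgen : ∀ η, generator n lam (fluctuation n ρ f) η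
      = (Real.sqrt n)⁻¹ * ∑ x, H x (η (x - 1)) (η x) (η (x + 1)) :=
    fun η => generator_fluctuation lam ρ f η
  have hHb : ∀ x a b c, |H x a b c| ≤ M + M * (2 + lam) := by
    intro x a b c
    refine (abs_add_le _ _).trans (add_le_add ?_ ?_)
    · rw [abs_mul]
      have e1 := abs_centered_le h0 h1 (fun _ : Unit => b) ()
      exact (mul_le_mul (hbl n x) e1 (abs_nonneg _) hM.le).trans_eq (mul_one _)
    · rw [abs_mul]
      refine mul_le_mul (hbf _) ?_ (abs_nonneg _) hM.le
      rw [abs_le]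
      constructor <;> cases a <;> cases b <;> cases c <;> simp [ho] <;> linarith
  refine ⟨fun η => ?_, fun hn3 s => ?_⟩
  · rw [hgen, abs_mul, abs_inv, abs_of_pos hs, inv_mul_le_iff₀ hs]
    refine (Finset.abs_sum_le_sum_abs _ _).trans
      ((Finset.sum_le_sum fun x _ => hHb x _ _ _).trans (le_of_eq ?_))
    rw [Finset.sum_const, Finset.card_univ, ZMod.card, nsmul_eq_mul]
    have := Real.mul_self_sqrt hn.le
    linear_combination -(M + M * (2 + lam)) * this
  -- The reaction term has mean f(x/n)F(ρ) = 0; otherwise the drift would have a mean of order √n in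
  -- general.
  · have hmean : mean (ρ : ℝ)
        (fun η : Config (ZMod n) => ∑ x, H x (η (x - 1)) (η x) (η (x + 1))) = 0 := by
      rw [mean_sum]
      refine Finset.sum_eq_zero fun x _ => (mean_three_sites hn3 ρ x (H x)).trans ?_
      simp [siteWeight, hH, ho]
      linear_combination F x * hF
    have := mean_exp_le h0 h1 (boundedDifferences_three_sites H hHb) hmean (s * (Real.sqrt n)⁻¹)
    simp only [hgen, ← mul_assoc]
    refine this.trans (le_of_eq ?_)
    rw [ZMod.card, mul_pow, inv_pow, Real.sq_sqrt hn.le]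
    congr 1
    field_simp

end Fluctuation

/-! ### Moments along the process -/

section Moments

lemma IsMarkovProcess.integral_comp {E : Type*} [Fintype E] [TopologicalSpace E]
    [MeasurableSpace E] [DiscreteMeasurableSpace E] {L : (E → ℝ) →ₗ[ℝ] (E → ℝ)} {μ₀ : Measure E}
    {Ω : Type*} [MeasurableSpace Ω] {P : Measure Ω} [IsProbabilityMeasure P] {η : ℝ → Ω → E}
    (h : IsMarkovProcess L μ₀ P η) {t : ℝ} (ht : 0 ≤ t) (g : E → ℝ) :
    ∫ ω, g (η t ω) ∂P = ∫ x, semigroup L t g x ∂μ₀ := by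
  have hle : past η 0 ≤ ‹MeasurableSpace Ω› :=
    iSup₂_le fun r hr => (h.measurable r hr.1).comap_le
  rw [← integral_condExp hle, integral_congr_ae (h.markov 0 t le_rfl ht g), sub_zero, ← h.initial,
    integral_map (h.measurable 0 le_rfl).aemeasurable
      (Measurable.of_discrete).aestronglyMeasurable]

/-- Positivity is read off the process: the conditional expectation of g given time 0 is almost
surely at least 1, and almost surely means everywhere because each state has positive initial mass.
-/
lemma IsMarkovProcess.semigroup_pos {E : Type*} [Fintype E] [TopologicalSpace E]
    [MeasurableSpace E] [DiscreteMeasurableSpace E] {L : (E → ℝ) →ₗ[ℝ] (E → ℝ)} {μ₀ : Measure E}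
    {Ω : Type*} [MeasurableSpace Ω] {P : Measure Ω} [IsProbabilityMeasure P] {η : ℝ → Ω → E}
    (h : IsMarkovProcess L μ₀ P η) (hμ : ∀ x, μ₀ {x} ≠ 0) {t : ℝ} (ht : 0 ≤ t) {g : E → ℝ}
    (hg : ∀ x, 1 ≤ g x) (x : E) : 0 < semigroup L t g x := by
  have hle : past η 0 ≤ ‹MeasurableSpace Ω› :=
    iSup₂_le fun r hr => (h.measurable r hr.1).comap_le
  have hint : Integrable (fun ω => g (η t ω)) P :=
    (Integrable.of_finite (μ := P.map (η t)) (f := g)).comp_measurable (h.measurable t ht)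
  have h1 : (fun _ => (1 : ℝ)) ≤ᵐ[P] P[fun ω => g (η t ω) | past η 0] := by
    have := condExp_mono (m := past η 0) (integrable_const (1 : ℝ)) hint
      (ae_of_all P fun ω => hg (η t ω))
    rwa [condExp_const hle] at this
  have h2 : ∀ᵐ ω ∂P, 1 ≤ semigroup L t g (η 0 ω) := by
    filter_upwards [h1, h.markov 0 t le_rfl ht g] with ω a b
    rw [sub_zero] at b
    rw [← b]
    exact a
  have h3 : ∃ᵐ ω ∂P, η 0 ω = x := by
    rw [frequently_ae_iff]
    have := hμ x
    rwa [← h.initial, Measure.map_apply (h.measurable 0 le_rfl) (measurableSet_singleton x)] at this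
  obtain ⟨ω, hω, hx⟩ := (h3.and_eventually h2).exists
  rw [← hω]
  linarith

/-- With m = θQ ≥ 1, raise 1 + r ≤ m exp(r/m) to the power m. -/
lemma one_add_rpow_le_exp {r θ Q : ℝ} (hr : 0 ≤ r) (hθ : 1 < θ) (hQ : 2 ≤ Q) :
    (1 + r ^ θ) ^ Q ≤ 2 ^ Q * (θ * Q) ^ (θ * Q) * Real.exp r := by
  have hθQ : 1 ≤ θ * Q := by nlinarith
  have h1 : 1 + r ≤ θ * Q * Real.exp (r / (θ * Q)) := by
    have := Real.add_one_le_exp (r / (θ * Q))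
    have h2 := mul_le_mul_of_nonneg_left this (by linarith : 0 ≤ θ * Q)
    rw [mul_add, mul_div_cancel₀ _ (by linarith)] at h2
    linarith
  have h2 : 1 + r ^ θ ≤ 2 * (1 + r) ^ θ := by
    have e1 : r ^ θ ≤ (1 + r) ^ θ := Real.rpow_le_rpow hr (by linarith) (by linarith)
    have e2 : 1 ≤ (1 + r) ^ θ := Real.one_le_rpow (by linarith) (by linarith)
    linarith
  calc (1 + r ^ θ) ^ Q ≤ (2 * (1 + r) ^ θ) ^ Q :=
        Real.rpow_le_rpow (by positivity) h2 (by linarith)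
    _ = 2 ^ Q * (1 + r) ^ (θ * Q) := by
        rw [Real.mul_rpow (by norm_num) (by positivity), ← Real.rpow_mul (by linarith)]
    _ ≤ 2 ^ Q * (θ * Q * Real.exp (r / (θ * Q))) ^ (θ * Q) := by
        gcongr
    _ = _ := by
        rw [Real.mul_rpow (by linarith) (Real.exp_pos _).le, ← Real.exp_mul,
          div_mul_cancel₀ _ (by linarith), mul_assoc]

universe u

/-- Uniform moment bounds for the drift of the fluctuation field along the process. -/
theorem integral_abs_generator_rpow_le {lam : ℝ} (hlam : 0 < lam) {ρ : I} (h0 : (0 : ℝ) < ρ)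
    (h1 : (ρ : ℝ) < 1) (hF : forcing lam ρ = 0) {T : ℝ} (hT : 0 < T) {f : UnitAddCircle → ℝ}
    (hf : ContDiff ℝ ((⊤ : ℕ∞) : WithTop ℕ∞) (fun u : ℝ => f (u : UnitAddCircle)))
    {θ : ℝ} (hθ : 1 < θ) :
    ∃ C : ℝ, 0 < C ∧ ∀ (n : ℕ) [NeZero n] (Ω : Type u) [MeasurableSpace Ω] (P : Measure Ω)
      [IsProbabilityMeasure P] (η : ℝ → Ω → Config (ZMod n)), IsReactionDiffusion n lam ρ P η →
      ∀ t ∈ Set.Icc (0 : ℝ) T,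
        ∫ ω, |generator n lam (fluctuation n ρ f) (η t ω)| ^ θ ∂P ≤ C := by
  rw [forcing_eq] at hF
  obtain ⟨Q, C, hQ, hC, hhyp⟩ := mean_semigroup_le hlam h0 h1 hF hT
  obtain ⟨A, hA, hgen⟩ := generator_fluctuation_bounds hlam h0 h1 hF hf
  set M := 2 ^ Q * (θ * Q) ^ (θ * Q) * (2 * Real.exp ((6 * A) ^ 2 / 2)) with hM
  have hθQ : 0 < θ * Q := by nlinarith
  have hM0 : 0 < M := by positivity
  refine ⟨C * M ^ (1 / Q) + (A * Real.sqrt 3) ^ θ, by positivity, ?_⟩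
  intro n _ Ω _ P _ η hη t ht
  have hint : ∀ g : Config (ZMod n) → ℝ, Integrable (fun ω => g (η t ω)) P := fun g =>
    (Integrable.of_finite (μ := P.map (η t)) (f := g)).comp_measurable (hη.measurable t ht.1)
  by_cases hn : 3 ≤ n
  · set R := generator n lam (fluctuation n ρ f) with hR
    -- The summand 1 keeps g, and hence its evolution, strictly positive, as the `L^Q` estimate
    -- requires.
    set g : Config (ZMod n) → ℝ := fun ζ => 1 + |R ζ| ^ θ with hg
    have hg1 : ∀ ζ, 1 ≤ g ζ := fun ζ => by
      have : 0 ≤ |R ζ| ^ θ := by positivity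
      simp only [hg]; linarith
    have hμ : ∀ ζ : Config (ZMod n), bernoulliProduct (ZMod n) ρ {ζ} ≠ 0 := by
      intro ζ hζ
      have := bernoulliProduct_real_singleton ρ ζ
      rw [measureReal_def, hζ, ENNReal.toReal_zero] at this
      exact (weight_pos h0 h1 ζ).ne this
    have e1 := hhyp n hn g (fun s hs ζ => hη.semigroup_pos hμ hs hg1 ζ) t ht
    have e2 : mean (ρ : ℝ) (fun ζ => g ζ ^ Q) ≤ M := by
      have hpt : ∀ ζ, g ζ ^ Q ≤ 2 ^ Q * (θ * Q) ^ (θ * Q)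
          * (Real.exp (1 * R ζ) + Real.exp (-1 * R ζ)) := by
        intro ζ
        refine (one_add_rpow_le_exp (abs_nonneg _) hθ hQ).trans ?_
        refine mul_le_mul_of_nonneg_left ?_ (by positivity)
        rcases abs_cases (R ζ) with ⟨h, _⟩ | ⟨h, _⟩ <;> rw [h]
        · rw [one_mul]; linarith [Real.exp_pos (-1 * R ζ)]
        · rw [neg_one_mul]; linarith [Real.exp_pos (1 * R ζ)]
      refine (mean_mono h0 h1 hpt).trans ?_
      rw [mean_const_mul, mean_add, hM]
      refine mul_le_mul_of_nonneg_left ?_ (by positivity)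
      have a1 := (hgen n).2 hn 1
      have a2 := (hgen n).2 hn (-1)
      norm_num at a1 a2 ⊢
      linarith
    have e3 : mean (ρ : ℝ) (fun ζ => g ζ ^ Q) ^ (1 / Q) ≤ M ^ (1 / Q) := by
      refine Real.rpow_le_rpow (mean_pos h0 h1 fun ζ => ?_).le e2 (by positivity)
      exact Real.rpow_pos_of_pos (by linarith [hg1 ζ]) _
    have e4 := hη.integral_comp ht.1 g
    rw [integral_bernoulliProduct] at e4
    have e5 : ∫ ω, |R (η t ω)| ^ θ ∂P ≤ ∫ ω, g (η t ω) ∂P :=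
      integral_mono (hint fun ζ => |R ζ| ^ θ) (hint g) fun ω => by simp [hg]
    have e6 := mul_le_mul_of_nonneg_left e3 hC.le
    have e7 : 0 ≤ (A * Real.sqrt 3) ^ θ := by positivity
    linarith
  -- On tori with fewer than three sites the deterministic bound A√n is enough.
  · have hb : ∀ ω, |generator n lam (fluctuation n ρ f) (η t ω)| ^ θ ≤ (A * Real.sqrt 3) ^ θ := by
      intro ω
      refine Real.rpow_le_rpow (abs_nonneg _) (((hgen n).1 _).trans ?_) (by linarith)
      refine mul_le_mul_of_nonneg_left (Real.sqrt_le_sqrt ?_) hA.le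
      have : n ≤ 3 := by omega
      exact_mod_cast this
    have e1 := integral_mono (hint fun ζ => |generator n lam (fluctuation n ρ f) ζ| ^ θ)
      (integrable_const _) hb
    simp only [integral_const, probReal_univ, smul_eq_mul, one_mul] at e1
    have e2 : 0 ≤ C * M ^ (1 / Q) := by positivity
    linarith

end Moments

/-! ### Time integrals along right-continuous processes -/

section TimeIntegrals

/-- Time is rounded up to a grid of mesh 1/(N + 1). The rounded process is jointly measurable,
having countably many times, and converges by right continuity. -/
lemma measurable_uncurry_of_right_continuous {E Ω : Type*} [TopologicalSpace E]
    [TopologicalSpace.PseudoMetrizableSpace E] [MeasurableSpace E] [BorelSpace E]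
    [MeasurableSpace Ω] {η : ℝ → Ω → E} (hm : ∀ t, 0 ≤ t → Measurable (η t))
    (hc : ∀ ω t, 0 ≤ t → ContinuousWithinAt (fun r => η r ω) (Set.Ici t) t) :
    Measurable (fun z : ℝ × Ω => η (max z.1 0) z.2) := by
  set d : ℕ → ℝ → ℝ := fun N r => ((⌊max r 0 * (N + 1)⌋₊ : ℝ) + 1) / (N + 1) with hd
  have hmeas : ∀ N : ℕ, Measurable (fun z : ℝ × Ω => η (d N z.1) z.2) := by
    intro N
    have h1 : Measurable (fun w : ℕ × Ω => η (((w.1 : ℝ) + 1) / (N + 1)) w.2) :=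
      measurable_from_prod_countable_right fun k =>
        hm (((k : ℝ) + 1) / (N + 1)) (by positivity)
    have h2 : Measurable (fun z : ℝ × Ω => (⌊max z.1 0 * ((N : ℝ) + 1)⌋₊, z.2)) := by
      fun_prop
    exact h1.comp h2
  refine measurable_of_tendsto_metrizable hmeas (tendsto_pi_nhds.2 fun z => ?_)
  have hpos : 0 ≤ max z.1 0 := le_max_right _ _
  have hlow : ∀ N : ℕ, max z.1 0 ≤ d N z.1 := by
    intro N
    rw [hd, le_div_iff₀ (by positivity)]
    exact (Nat.lt_floor_add_one _).le
  have hup : ∀ N : ℕ, d N z.1 ≤ max z.1 0 + 1 / ((N : ℝ) + 1) := by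
    intro N
    have hN : (0 : ℝ) < N + 1 := by positivity
    rw [hd, div_le_iff₀ hN, add_mul, one_div, inv_mul_cancel₀ hN.ne']
    have := Nat.floor_le (by positivity : 0 ≤ max z.1 0 * ((N : ℝ) + 1))
    linarith
  have hlim : Tendsto (fun N => d N z.1) atTop (𝓝 (max z.1 0)) := by
    refine tendsto_of_tendsto_of_tendsto_of_le_of_le tendsto_const_nhds ?_ hlow hup
    simpa using tendsto_const_nhds.add (tendsto_one_div_add_atTop_nhds_zero_nat (𝕜 := ℝ))
  exact (hc z.2 _ hpos).tendsto.comp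
    (tendsto_nhdsWithin_iff.2 ⟨hlim, Eventually.of_forall hlow⟩)

lemma intervalIntegrable_of_abs_le {v : ℝ → ℝ} (hv : Measurable v) {B : ℝ} (hB : ∀ r, |v r| ≤ B)
    (s t : ℝ) : IntervalIntegrable v volume s t :=
  (intervalIntegrable_const (c := B)).mono_fun hv.aestronglyMeasurable
    (ae_of_all _ fun r => (hB r).trans (le_abs_self B))

/-- Jensen's inequality for the time integral. -/
lemma abs_integral_rpow_le {v : ℝ → ℝ} (hv : Measurable v) {B : ℝ} (hB : ∀ r, |v r| ≤ B)
    {θ : ℝ} (hθ : 1 < θ) {s t : ℝ} (hst : s ≤ t) :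
    |∫ r in s..t, v r| ^ θ ≤ (t - s) ^ (θ - 1) * ∫ r in s..t, |v r| ^ θ := by
  rcases hst.eq_or_lt with rfl | hlt
  · simp [Real.zero_rpow (by linarith : θ ≠ 0)]
  have hts : 0 < t - s := by linarith
  have hmv : Measurable (fun r => |v r|) := hv.abs
  have hmp : Measurable (fun r => |v r| ^ θ) := hmv.pow_const θ
  have hi1 : IntegrableOn (fun r => |v r|) (Set.Ioc s t) :=
    (intervalIntegrable_of_abs_le hmv (by simpa using hB) s t).1
  have hi2 : IntegrableOn (fun r => |v r| ^ θ) (Set.Ioc s t) :=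
    (intervalIntegrable_of_abs_le hmp (B := B ^ θ) (fun r => by
      rw [abs_of_nonneg (by positivity)]
      exact Real.rpow_le_rpow (abs_nonneg _) (hB r) (by linarith)) s t).1
  have hJ := (convexOn_rpow hθ.le).map_set_average_le (μ := volume) (t := Set.Ioc s t)
    (f := fun r => |v r|) (Real.continuous_rpow_const (by linarith)).continuousOn isClosed_Ici
    (by simp [hlt]) (by simp) (ae_of_all _ fun r => Set.mem_Ici.2 (abs_nonneg _)) hi1 hi2
  rw [setAverage_eq, setAverage_eq, Real.volume_real_Ioc_of_le hst,
    ← intervalIntegral.integral_of_le hst, ← intervalIntegral.integral_of_le hst, smul_eq_mul,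
    smul_eq_mul, Real.mul_rpow (by positivity)
      (intervalIntegral.integral_nonneg hst fun r _ => abs_nonneg _), Real.inv_rpow hts.le,
    inv_mul_le_iff₀ (by positivity), ← mul_assoc, ← div_eq_mul_inv,
    ← Real.rpow_sub_one hts.ne'] at hJ
  refine le_trans ?_ hJ
  exact Real.rpow_le_rpow (abs_nonneg _)
    (intervalIntegral.abs_integral_le_integral_abs hst) (by linarith)

lemma integral_integral_rpow_le {Ω : Type*} [MeasurableSpace Ω] {P : Measure Ω}
    [IsProbabilityMeasure P] {v : ℝ → Ω → ℝ} (hv : Measurable (fun z : ℝ × Ω => v z.1 z.2))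
    {B : ℝ} (hB : ∀ r ω, |v r ω| ≤ B) {θ C s t : ℝ} (hθ : 1 < θ) (hst : s ≤ t)
    (hC : ∀ r ∈ Set.Icc s t, ∫ ω, |v r ω| ^ θ ∂P ≤ C) :
    Integrable (fun ω => ∫ r in s..t, |v r ω| ^ θ) P ∧
    ∫ ω, (∫ r in s..t, |v r ω| ^ θ) ∂P ≤ C * (t - s) := by
  have hm : Measurable (fun z : Ω × ℝ => |v z.2 z.1| ^ θ) :=
    ((hv.comp measurable_swap).abs).pow_const θ
  have hint : Integrable (fun z : Ω × ℝ => |v z.2 z.1| ^ θ)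
      (P.prod (volume.restrict (Set.Ioc s t))) := by
    refine Integrable.of_bound hm.aestronglyMeasurable (B ^ θ) (ae_of_all _ fun z => ?_)
    rw [Real.norm_eq_abs, abs_of_nonneg (by positivity)]
    exact Real.rpow_le_rpow (abs_nonneg _) (hB _ _) (by linarith)
  simp only [intervalIntegral.integral_of_le hst]
  refine ⟨hint.integral_prod_left, ?_⟩
  rw [integral_integral_swap hint, ← intervalIntegral.integral_of_le hst]
  refine (intervalIntegral.integral_mono_on hst ?_ intervalIntegrable_const hC).trans_eq ?_
  · rw [intervalIntegrable_iff_integrableOn_Ioc_of_le hst]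
    exact hint.integral_prod_right
  · rw [intervalIntegral.integral_const, smul_eq_mul, mul_comm]

lemma measurable_intervalIntegral {Ω : Type*} [MeasurableSpace Ω] {v : ℝ → Ω → ℝ}
    (hv : Measurable (fun z : ℝ × Ω => v z.1 z.2)) (s t : ℝ) :
    Measurable (fun ω => ∫ r in s..t, v r ω) := by
  have hm : StronglyMeasurable (fun z : Ω × ℝ => v z.2 z.1) :=
    (hv.comp measurable_swap).stronglyMeasurable
  simp only [intervalIntegral]
  exact (hm.integral_prod_right.measurable).sub (hm.integral_prod_right.measurable)

/-- Moments of the increments of a time integral. -/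
lemma integral_abs_integral_rpow_le {Ω : Type*} [MeasurableSpace Ω] {P : Measure Ω}
    [IsProbabilityMeasure P] {v : ℝ → Ω → ℝ} (hv : Measurable (fun z : ℝ × Ω => v z.1 z.2))
    {B : ℝ} (hB : ∀ r ω, |v r ω| ≤ B) {θ C s t : ℝ} (hθ : 1 < θ) (hst : s ≤ t)
    (hC : ∀ r ∈ Set.Icc s t, ∫ ω, |v r ω| ^ θ ∂P ≤ C) :
    Integrable (fun ω => |∫ r in s..t, v r ω| ^ θ) P ∧
    ∫ ω, |∫ r in s..t, v r ω| ^ θ ∂P ≤ C * (t - s) ^ θ := by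
  have hsec : ∀ ω, Measurable fun r => v r ω := fun ω => hv.comp measurable_prodMk_right
  obtain ⟨hi, hle⟩ := integral_integral_rpow_le hv hB hθ hst hC
  have hpt : ∀ ω, |∫ r in s..t, v r ω| ^ θ ≤ (t - s) ^ (θ - 1) * ∫ r in s..t, |v r ω| ^ θ :=
    fun ω => abs_integral_rpow_le (hsec ω) (fun r => hB r ω) hθ hst
  have hint : Integrable (fun ω => |∫ r in s..t, v r ω| ^ θ) P := by
    refine (hi.const_mul ((t - s) ^ (θ - 1))).mono'
      (((measurable_intervalIntegral hv s t).abs).pow_const θ).aestronglyMeasurable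
      (ae_of_all _ fun ω => ?_)
    rw [Real.norm_eq_abs, abs_of_nonneg (by positivity)]
    exact hpt ω
  refine ⟨hint, (integral_mono hint (hi.const_mul _) hpt).trans ?_⟩
  rw [integral_const_mul]
  have hts : 0 ≤ t - s := by linarith
  refine (mul_le_mul_of_nonneg_left hle (by positivity)).trans (le_of_eq ?_)
  rcases hts.eq_or_lt with h | h
  · rw [← h, Real.zero_rpow (by linarith), Real.zero_rpow (by linarith)]; simp
  · rw [Real.rpow_sub_one h.ne']
    field_simp

end TimeIntegrals

/-! ### Tightness in the space of continuous paths -/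

section Tightness

/-- The path space is separable, so balls generate its Borel sets, and the uniform distance to a
fixed path is determined by countably many times. -/
lemma measurable_path_of_measurable_eval {T : ℝ} {Ω : Type*} [MeasurableSpace Ω]
    {Y : Ω → C(Set.Icc (0 : ℝ) T, ℝ)} (h : ∀ t, Measurable fun ω => Y ω t) : Measurable Y := by
  have hdist : ∀ g : C(Set.Icc (0 : ℝ) T, ℝ), Measurable fun ω => dist (Y ω) g := by
    intro g
    refine measurable_of_Iic fun r => ?_
    by_cases hr : 0 ≤ r
    · obtain ⟨D, hDc, hD⟩ := TopologicalSpace.exists_countable_dense (Set.Icc (0 : ℝ) T)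
      have : (fun ω => dist (Y ω) g) ⁻¹' Set.Iic r = ⋂ t ∈ D, {ω | dist (Y ω t) (g t) ≤ r} := by
        ext ω
        simp only [Set.mem_preimage, Set.mem_Iic, Set.mem_iInter, Set.mem_ofPred_eq]
        rw [ContinuousMap.dist_le hr]
        refine ⟨fun hω t _ => hω t, fun hω t => ?_⟩
        have hcl : IsClosed {t | dist (Y ω t) (g t) ≤ r} :=
          isClosed_le ((Y ω).continuous.dist g.continuous) continuous_const
        exact hcl.closure_subset_iff.2 hω (hD t)
      rw [this]
      exact MeasurableSet.biInter hDc fun t _ =>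
        measurableSet_le ((h t).dist measurable_const) measurable_const
    · have : (fun ω => dist (Y ω) g) ⁻¹' Set.Iic r = ∅ := by
        ext ω
        simp only [Set.mem_preimage, Set.mem_Iic, Set.mem_empty_iff_false, iff_false]
        exact fun hle => hr (dist_nonneg.trans hle)
      rw [this]
      exact MeasurableSet.empty
  have hB : TopologicalSpace.IsTopologicalBasis
      {s : Set C(Set.Icc (0 : ℝ) T, ℝ) | ∃ g r, s = Metric.ball g r} := by
    refine TopologicalSpace.isTopologicalBasis_of_isOpen_of_nhds ?_ ?_
    · rintro _ ⟨g, r, rfl⟩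
      exact Metric.isOpen_ball
    · intro g U hg hU
      obtain ⟨r, hr, hrU⟩ := Metric.isOpen_iff.1 hU g hg
      exact ⟨_, ⟨g, r, rfl⟩, Metric.mem_ball_self hr, hrU⟩
  have hgen := hB.borel_eq_generateFrom
  change @Measurable _ _ _ (borel _) Y
  rw [hgen]
  refine measurable_generateFrom ?_
  rintro _ ⟨g, r, rfl⟩
  exact measurableSet_lt (hdist g) measurable_const

/-- Bounded paths that are Hölder continuous of exponent `1 / 2`, with constants set by `R`. -/
def holderPaths (T R : ℝ) : Set C(Set.Icc (0 : ℝ) T, ℝ) :=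
  {y | (∀ t, |y t| ≤ Real.sqrt (R * T)) ∧ ∀ s t, |y t - y s| ≤ Real.sqrt (R * dist t s)}

lemma isCompact_holderPaths (T R : ℝ) : IsCompact (holderPaths T R) := by
  have htend : Tendsto (fun d => Real.sqrt (R * d)) (𝓝 0) (𝓝 0) := by
    have : Continuous fun d => Real.sqrt (R * d) := by fun_prop
    simpa using this.tendsto 0
  refine ArzelaAscoli.isCompact_of_equicontinuous _ ?_ ?_
  -- The Hölder condition forces continuity, so the image in the product space is cut out by
  -- pointwise closed conditions and is a closed subset of a compact box.
  · have himage : ContinuousMap.toFun '' holderPaths T R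
        = {y : Set.Icc (0 : ℝ) T → ℝ | (∀ t, |y t| ≤ Real.sqrt (R * T)) ∧
            ∀ s t, |y t - y s| ≤ Real.sqrt (R * dist t s)} := by
      ext y
      constructor
      · rintro ⟨z, hz, rfl⟩
        exact hz
      · intro hy
        have hc : Continuous y := by
          refine continuous_iff_continuousAt.2 fun s => ?_
          rw [ContinuousAt, tendsto_iff_dist_tendsto_zero]
          have hd : Tendsto (fun t => Real.sqrt (R * dist t s)) (𝓝 s) (𝓝 0) :=
            htend.comp (tendsto_iff_dist_tendsto_zero.1 tendsto_id)
          exact squeeze_zero (fun _ => dist_nonneg) (fun t => hy.2 s t) hd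
        exact ⟨⟨y, hc⟩, hy, rfl⟩
    rw [himage]
    refine (isCompact_univ_pi fun _ : Set.Icc (0 : ℝ) T =>
      isCompact_Icc (a := -Real.sqrt (R * T)) (b := Real.sqrt (R * T))).of_isClosed_subset ?_ ?_
    · have hset : {y : Set.Icc (0 : ℝ) T → ℝ | (∀ t, |y t| ≤ Real.sqrt (R * T)) ∧
            ∀ s t, |y t - y s| ≤ Real.sqrt (R * dist t s)}
          = (⋂ t, {y | |y t| ≤ Real.sqrt (R * T)})
            ∩ ⋂ s, ⋂ t, {y | |y t - y s| ≤ Real.sqrt (R * dist t s)} := by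
        ext y; simp only [Set.mem_inter_iff, Set.mem_iInter, Set.mem_ofPred_eq]
      rw [hset]
      refine IsClosed.inter (isClosed_iInter fun t => ?_)
        (isClosed_iInter fun s => isClosed_iInter fun t => ?_)
      · exact isClosed_le (continuous_apply t).abs continuous_const
      · exact isClosed_le ((continuous_apply t).sub (continuous_apply s)).abs continuous_const
    · intro y hy t _
      exact abs_le.1 (hy.1 t)
  · exact Metric.equicontinuous_of_continuity_modulus _ htend _ fun s t y => by
      rw [dist_comm, dist_comm s t]
      exact y.2.2 s t

end Tightness

/-- The primitive of a bounded process is a random continuous path, and it is Hölder continuous with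
high probability. -/
lemma exists_primitive_path {Ω : Type*} [MeasurableSpace Ω] {P : Measure Ω}
    [IsProbabilityMeasure P] {v : ℝ → Ω → ℝ} (hv : Measurable (fun z : ℝ × Ω => v z.1 z.2))
    {B : ℝ} (hB : ∀ r ω, |v r ω| ≤ B) {C T : ℝ} (hT : 0 < T)
    (hC : ∀ r ∈ Set.Icc (0 : ℝ) T, ∫ ω, |v r ω| ^ (2 : ℝ) ∂P ≤ C) :
    ∃ Y : Ω → C(Set.Icc (0 : ℝ) T, ℝ),
      (∀ ω t, Y ω t = ∫ r in (0 : ℝ)..t, v r ω) ∧ Measurable Y ∧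
      ∀ R, 0 < R → R * P.real (Y ⁻¹' (holderPaths T R)ᶜ) ≤ C * T := by
  have hsec : ∀ ω, Measurable fun r => v r ω :=
    fun ω => hv.comp measurable_prodMk_right
  have hii : ∀ ω s t, IntervalIntegrable (fun r => v r ω) volume s t :=
    fun ω => intervalIntegrable_of_abs_le (hsec ω) fun r => hB r ω
  let Y : Ω → C(Set.Icc (0 : ℝ) T, ℝ) := fun ω =>
    ⟨fun t => ∫ r in (0 : ℝ)..t, v r ω,
      (intervalIntegral.continuous_primitive (hii ω) 0).comp continuous_subtype_val⟩
  have hY : ∀ ω t, Y ω t = ∫ r in (0 : ℝ)..t, v r ω := fun _ _ => rfl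
  refine ⟨Y, hY, ?_, fun R hR => ?_⟩
  · exact measurable_path_of_measurable_eval fun t => measurable_intervalIntegral hv 0 t
  -- One random constant bounds every increment, |Y_t - Y_s|² ≤ M(t - s), so no chaining over times
  -- is needed.
  set M : Ω → ℝ := fun ω => ∫ r in (0 : ℝ)..T, |v r ω| ^ (2 : ℝ) with hM
  obtain ⟨hMi, hMle⟩ := integral_integral_rpow_le (P := P) (θ := 2) (C := C) hv hB (by norm_num)
    hT.le hC
  rw [sub_zero] at hMle
  have hM0 : ∀ ω, 0 ≤ M ω := fun ω =>
    intervalIntegral.integral_nonneg hT.le fun r _ => by positivity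
  have hsq : ∀ ω, IntervalIntegrable (fun r => |v r ω| ^ (2 : ℝ)) volume 0 T :=
    fun ω => intervalIntegrable_of_abs_le (((hsec ω).abs).pow_const _) (B := B ^ (2 : ℝ))
      (fun r => by
        rw [abs_of_nonneg (by positivity)]
        exact Real.rpow_le_rpow (abs_nonneg _) (hB r ω) (by norm_num)) 0 T
  have hincr : ∀ ω, ∀ s t : Set.Icc (0 : ℝ) T, (s : ℝ) ≤ t →
      |Y ω t - Y ω s| ≤ Real.sqrt (M ω * (t - s)) := by
    intro ω s t hst
    have e1 : Y ω t - Y ω s = ∫ r in (s : ℝ)..t, v r ω :=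
      intervalIntegral.integral_interval_sub_left (hii ω 0 t) (hii ω 0 s)
    have e2 := abs_integral_rpow_le (hsec ω) (fun r => hB r ω) (by norm_num : (1 : ℝ) < 2) hst
    have e3 : ∫ r in (s : ℝ)..t, |v r ω| ^ (2 : ℝ) ≤ M ω :=
      intervalIntegral.integral_mono_interval s.2.1 hst t.2.2
        (ae_of_all _ fun r => by positivity) (hsq ω)
    rw [e1]
    refine Real.le_sqrt_of_sq_le ?_
    rw [show (2 : ℝ) - 1 = 1 by norm_num, Real.rpow_one, Real.rpow_two] at e2
    have hts : 0 ≤ (t : ℝ) - s := by linarith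
    nlinarith
  have hsub : Y ⁻¹' (holderPaths T R)ᶜ ⊆ {ω | R ≤ M ω} := by
    intro ω hω
    by_contra hlt
    have hlt' : M ω ≤ R := (not_le.1 hlt).le
    refine hω ⟨fun t => ?_, fun s t => ?_⟩
    · have h := hincr ω ⟨0, le_rfl, hT.le⟩ t t.2.1
      have h0 : Y ω ⟨0, le_rfl, hT.le⟩ = 0 := by rw [hY]; simp
      rw [h0, sub_zero] at h
      refine h.trans (Real.sqrt_le_sqrt ?_)
      simp only [sub_zero]
      exact mul_le_mul hlt' t.2.2 t.2.1 hR.le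
    · rcases le_total (s : ℝ) t with hst | hst
      · refine (hincr ω s t hst).trans (Real.sqrt_le_sqrt ?_)
        rw [Subtype.dist_eq, Real.dist_eq, abs_of_nonneg (by linarith)]
        exact mul_le_mul_of_nonneg_right hlt' (by linarith)
      · rw [abs_sub_comm]
        refine (hincr ω t s hst).trans (Real.sqrt_le_sqrt ?_)
        rw [dist_comm, Subtype.dist_eq, Real.dist_eq, abs_of_nonneg (by linarith)]
        exact mul_le_mul_of_nonneg_right hlt' (by linarith)
  have hmarkov := mul_meas_ge_le_integral_of_nonneg (ae_of_all P hM0) hMi R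
  refine (mul_le_mul_of_nonneg_left (measureReal_mono hsub) hR.le).trans (hmarkov.trans hMle)

/-! ### The additive functional -/

section AdditiveFunctional

set_option linter.unusedSectionVars false

variable {n : ℕ} [NeZero n] {lam : ℝ} {ρ : I} {f : UnitAddCircle → ℝ} {Ω : Type*}
  [MeasurableSpace Ω] {P : Measure Ω} {η : ℝ → Ω → Config (ZMod n)}

/-- The drift of the fluctuation field along the process, extended by its value at time `0` to
negative times. -/
def drift (lam : ℝ) (ρ : I) (f : UnitAddCircle → ℝ) (η : ℝ → Ω → Config (ZMod n)) (r : ℝ)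
    (ω : Ω) : ℝ :=
  generator n lam (fluctuation n ρ f) (η (max r 0) ω)

lemma IsReactionDiffusion.measurable_drift (hη : IsReactionDiffusion n lam ρ P η) :
    Measurable (fun z : ℝ × Ω => drift lam ρ f η z.1 z.2) := by
  have h := measurable_uncurry_of_right_continuous hη.measurable hη.right_continuous
  exact (Measurable.of_discrete (f := generator n lam (fluctuation n ρ f))).comp h

lemma exists_abs_drift_le (lam : ℝ) (ρ : I) (f : UnitAddCircle → ℝ)
    (η : ℝ → Ω → Config (ZMod n)) : ∃ B, ∀ r ω, |drift lam ρ f η r ω| ≤ B := by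
  obtain ⟨B, hB⟩ := Finite.bddAbove_range fun ζ => |generator n lam (fluctuation n ρ f) ζ|
  exact ⟨B, fun r ω => hB ⟨_, rfl⟩⟩

lemma additiveFunctional_eq {s t : ℝ} (hs : 0 ≤ s) (ht : 0 ≤ t) (ω : Ω) :
    additiveFunctional n lam ρ f η s t ω = ∫ r in s..t, drift lam ρ f η r ω := by
  refine intervalIntegral.integral_congr fun r hr => ?_
  have : 0 ≤ r := (le_min hs ht).trans hr.1
  simp only [drift, max_eq_left this]

lemma drift_of_nonneg {r : ℝ} (hr : 0 ≤ r) (ω : Ω) :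
    drift lam ρ f η r ω = generator n lam (fluctuation n ρ f) (η r ω) := by
  rw [drift, max_eq_left hr]

lemma integral_abs_additiveFunctional_rpow_le [IsProbabilityMeasure P]
    (hη : IsReactionDiffusion n lam ρ P η) {θ C T : ℝ} (hθ : 1 < θ)
    (hC : ∀ r ∈ Set.Icc (0 : ℝ) T,
      ∫ ω, |generator n lam (fluctuation n ρ f) (η r ω)| ^ θ ∂P ≤ C)
    {s t : ℝ} (hs : s ∈ Set.Icc (0 : ℝ) T) (ht : t ∈ Set.Icc (0 : ℝ) T) :
    Integrable (fun ω => |additiveFunctional n lam ρ f η s t ω| ^ θ) P ∧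
      ∫ ω, |additiveFunctional n lam ρ f η s t ω| ^ θ ∂P ≤ C * |t - s| ^ θ := by
  wlog hst : s ≤ t generalizing s t with H
  · have h := H ht hs (le_of_not_ge hst)
    have e : ∀ ω, additiveFunctional n lam ρ f η s t ω = -additiveFunctional n lam ρ f η t s ω :=
      fun ω => intervalIntegral.integral_symm _ _
    simp only [e, abs_neg]
    rwa [abs_sub_comm]
  obtain ⟨B, hB⟩ := exists_abs_drift_le lam ρ f η
  simp only [additiveFunctional_eq hs.1 ht.1]
  rw [abs_of_nonneg (by linarith : 0 ≤ t - s)]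
  refine integral_abs_integral_rpow_le hη.measurable_drift hB hθ hst fun r hr => ?_
  have hr0 : 0 ≤ r := hs.1.trans hr.1
  simp only [drift_of_nonneg hr0]
  exact hC r ⟨hr0, hr.2.trans ht.2⟩

/-- The additive functional as a random continuous path. -/
lemma IsReactionDiffusion.exists_path [IsProbabilityMeasure P]
    (hη : IsReactionDiffusion n lam ρ P η) {C T : ℝ} (hT : 0 < T)
    (hC : ∀ r ∈ Set.Icc (0 : ℝ) T,
      ∫ ω, |generator n lam (fluctuation n ρ f) (η r ω)| ^ (2 : ℝ) ∂P ≤ C) :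
    ∃ Y : Ω → C(Set.Icc (0 : ℝ) T, ℝ),
      (∀ ω t, Y ω t = additiveFunctional n lam ρ f η 0 t ω) ∧ Measurable Y ∧
      ∀ R, 0 < R → R * P.real (Y ⁻¹' (holderPaths T R)ᶜ) ≤ C * T := by
  obtain ⟨B, hB⟩ := exists_abs_drift_le lam ρ f η
  obtain ⟨Y, hY, hYm, hYR⟩ := exists_primitive_path (P := P) (C := C)
    (hη.measurable_drift (f := f)) hB hT (fun r hr => by
      simp only [drift_of_nonneg hr.1]
      exact hC r hr)
  exact ⟨Y, fun ω t => by rw [hY, additiveFunctional_eq le_rfl t.2.1], hYm, hYR⟩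

end AdditiveFunctional

end ReactionDiffusion

end

/-! ### The moment bound and tightness -/

open ReactionDiffusion in
theorem mainTheorem5
    (lam : ℝ) (hlam : 0 < lam)
    (ρ : unitInterval) (hρ0 : 0 < ρ) (hρ1 : ρ < 1)
    (hF : ReactionDiffusion.forcing lam ρ = 0)
    (T : ℝ) (hT : 0 < T)
    (f : UnitAddCircle → ℝ) (hf : ContDiff ℝ ((⊤ : ℕ∞) : WithTop ℕ∞) (fun u : ℝ => f (u : UnitAddCircle))) :
    (∀ θ : ℝ, 1 < θ → ∃ C : ℝ, 0 < C ∧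
      ∀ (n : ℕ) [NeZero n] (Ω : Type*) [MeasurableSpace Ω]
        (P : Measure Ω) [IsProbabilityMeasure P] (η : ℝ → Ω → ReactionDiffusion.Config (ZMod n)),
        ReactionDiffusion.IsReactionDiffusion n lam ρ P η →
        ∀ s ∈ Set.Icc (0 : ℝ) T, ∀ t ∈ Set.Icc (0 : ℝ) T,
          Integrable
            (fun ω => |ReactionDiffusion.additiveFunctional n lam ρ f η s t ω| ^ θ) P ∧
          ∫ ω, |ReactionDiffusion.additiveFunctional n lam ρ f η s t ω| ^ θ ∂P
            ≤ C * |t - s| ^ θ) ∧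
    (∀ (Ω : ℕ+ → Type*) [∀ n, MeasurableSpace (Ω n)]
        (P : ∀ n, Measure (Ω n)) [∀ n, IsProbabilityMeasure (P n)]
        (η : ∀ n : ℕ+, ℝ → Ω n → ReactionDiffusion.Config (ZMod n)),
        (∀ n : ℕ+, ReactionDiffusion.IsReactionDiffusion n lam ρ (P n) (η n)) →
        ∃ Y : ∀ n : ℕ+, Ω n → C(Set.Icc (0 : ℝ) T, ℝ),
          (∀ n ω t, Y n ω t = ReactionDiffusion.additiveFunctional n lam ρ f (η n) 0 t ω) ∧
          (∀ n, Measurable (Y n)) ∧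
          IsTightMeasureSet (Set.range fun n => (P n).map (Y n))) := by
  have h0 : (0 : ℝ) < ρ := hρ0
  have h1 : (ρ : ℝ) < 1 := hρ1
  refine ⟨fun θ hθ => ?_, ?_⟩
  · obtain ⟨C, hC, hbd⟩ := integral_abs_generator_rpow_le hlam h0 h1 hF hT hf hθ
    refine ⟨C, hC, ?_⟩
    intro n _ Ω _ P _ η hη s hs t ht
    exact integral_abs_additiveFunctional_rpow_le hη hθ (hbd n Ω P η hη) hs ht
  · intro Ω _ P _ η hη
    obtain ⟨C, hC, hbd⟩ := integral_abs_generator_rpow_le hlam h0 h1 hF hT hf one_lt_two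
    choose Y hYeq hYm hYR using fun n : ℕ+ =>
      (hη n).exists_path hT (hbd n (Ω n) (P n) (η n) (hη n))
    refine ⟨Y, hYeq, hYm, ?_⟩
    rw [isTightMeasureSet_iff_exists_isCompact_measure_compl_le]
    intro ε hε
    by_cases hε' : ε = ⊤
    · exact ⟨∅, isCompact_empty, fun μ _ => by simp [hε']⟩
    have hpos : 0 < ε.toReal := ENNReal.toReal_pos hε.ne' hε'
    -- With this R, Markov's inequality bounds the mass outside the compact set by CT/R = ε for
    -- every n.
    set R := C * T / ε.toReal with hR
    have hR0 : 0 < R := by positivity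
    refine ⟨holderPaths T R, isCompact_holderPaths T R, ?_⟩
    rintro _ ⟨n, rfl⟩
    rw [Measure.map_apply (hYm n) (isCompact_holderPaths T R).isClosed.measurableSet.compl,
      ← ENNReal.ofReal_toReal hε', ← ofReal_measureReal]
    refine ENNReal.ofReal_le_ofReal ?_
    have h := hYR n R hR0
    have hCT : C * T = R * ε.toReal := by rw [hR]; field_simp
    rw [hCT] at h
    exact le_of_mul_le_mul_left h hR0
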